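/- Let $n,m,j\ge 1$ be integers. Let $\mathbb T\subset\mathbb R$ be a time scale (a non-empty closed set) with $a=\min\mathbb T$, unbounded above, and let $\mathbb T_1\subset\mathbb T$ be another time scale with $\min\mathbb T_1=a$, unbounded above. For $t\in\mathbb T$ put $\sigma(t)=\inf\{s\in\mathbb T: s>t\}$, $\mathrm{RS}=\{t\in\mathbb T:\sigma(t)>t\}$, $\Phi(t)=\sup\{s\in\mathbb T_1: s\le t\}$ and $u^\Phi=u\circ\Phi$; write $I_{\mathbb T}=I\cap\mathbb T$ for an interval $I$. Let $\mu_\Delta(A)=\mu_L(A)+\sum_{r\in A\cap \mathrm{RS}}(\sigma(r)-r)$ be the Lebesgue $\Delta$-measure of $\mathbb T$ ($\mu_L$ being Lebesgue measure, and $\Delta_1$ referring to the analogous measure of $\mathbb T_1$), and let $q^\Delta(t)=\lim_{s\to t,\ s\in\mathbb T,\ s\ne\sigma(t)}\frac{q(\sigma(t))-q(s)}{\sigma(t)-s}$ be the $\Delta$-derivative. Let $\Omega\subset\mathbb R^m$ be non-empty and closed, let $\mathrm S\subset\mathbb R^j$ be non-empty, closed and convex, let $g:\mathbb R^n\times\mathbb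 R^n\to\mathbb R^j$ be continuous, and let $f:\mathbb T\times\mathbb R^n\times\mathbb R^m\to\mathbb R^n$ and $f^0:\mathbb T\times\mathbb R^n\times\mathbb R^m\to\mathbb R$ be continuous and of class $C^1$ in $(q,u)$ for each fixed $t\in\mathbb T$. Let $L^\infty_{\mathbb T_1}(\mathbb T_1,\Omega)$ be the set of $\mu_{\Delta_1}$-measurable, $\Delta_1$-essentially bounded functions on $\mathbb T_1$ with values in $\Omega$ at $\Delta_1$-almost every point. The final time is either fixed, equal to a given $b_0\in\mathbb T$, or free in $\mathbb T$. Let $\mathcal M$ be the set of admissible trajectories, i.e. of functions $q:[a,b]_{\mathbb T}\to\mathbb R^n$, associated with an allowed final time $b\in\mathbb T$ (with $b=b_0$ if the final time is fixed; $b=a$ is allowed) and with a sampled-data control $u\in L^\infty_{\mathbb T_1}(\mathbb T_1,\Omega)$, that are absolutely continuous on $[a,b]_{\mathbb T}$ and satisfy $q^\Delta(t)=f(t,q(t),u^\Phi(t))$ for $\Delta$-a.e. $t\in[a,b)_{\mathbb T}$ and $g(q(a),q(b))\in\mathrm S$. The cost of such a triple $(b,u,q)$ is $\int_{[a,b)_{\mathbb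 T}}f^0(\tau,q(\tau),u^\Phi(\tau))\,\Delta\tau$ (which is $0$ if $b=a$), and an optimal solution is an admissible triple whose cost is minimal among all admissible triples. **Theorem.** Assume that $\Omega$ is compact, that $\mathcal M$ is non-empty, that there is $M\ge 0$ such that $\sup_{t\in[a,b]_{\mathbb T}}\|q(t)\|+b\le M$ for every $q\in\mathcal M$ with associated final time $b$, and that for every $(t,q)\in\mathbb T\times\mathbb R^n$ the set of extended velocities $\{(f(t,q,u),f^0(t,q,u)) : u\in\Omega\}$ is convex. Then the optimal sampled-data control problem of minimizing the cost over all admissible triples has at least one optimal solution. -/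

import Mathlib

open scoped ENNReal Topology

noncomputable section

namespace TimeScale

/-- `T` is a time scale (a non-empty closed subset of `ℝ`) with minimum `a` and unbounded above. -/
structure IsTimeScale (T : Set ℝ) (a : ℝ) : Prop where
  isClosed : IsClosed T
  isLeast : IsLeast T a
  not_bddAbove : ¬ BddAbove T

/-- The forward jump operator `σ(t) = inf {s ∈ T | s > t}`. -/
def jump (T : Set ℝ) (t : ℝ) : ℝ := sInf {s | s ∈ T ∧ t < s}

/-- The graininess `μ(t) = σ(t) - t`. -/
def graininess (T : Set ℝ) (t : ℝ) : ℝ := jump T t - t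

/-- The set `RS` of right-scattered points of `T`. -/
def rightScattered (T : Set ℝ) : Set ℝ := {t | t ∈ T ∧ t < jump T t}

/-- The Lebesgue `Δ`-measure of `T`, as a measure on `ℝ` carried by `T`:
`μ_Δ(A) = μ_L(A ∩ T) + ∑_{r ∈ A ∩ RS} μ(r)`. -/
def deltaMeasure (T : Set ℝ) : MeasureTheory.Measure ℝ :=
  MeasureTheory.volume.restrict T +
    MeasureTheory.Measure.sum
      (fun r : rightScattered T =>
        ENNReal.ofReal (graininess T (r : ℝ)) • MeasureTheory.Measure.dirac (r : ℝ))

/-- `q` is `Δ`-differentiable at `t` with `q^Δ(t) = v`: the quotient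
`(q(σ(t)) - q(s)) / (σ(t) - s)` tends to `v` as `s → t`, `s ∈ T`, `s ≠ σ(t)`.
The value `s = t` is excluded exactly when `t` is right-dense. -/
def HasDeltaDerivAt {E : Type*} [NormedAddCommGroup E] [NormedSpace ℝ E]
    (T : Set ℝ) (q : ℝ → E) (v : E) (t : ℝ) : Prop :=
  Filter.Tendsto (fun s : ℝ => (jump T t - s)⁻¹ • (q (jump T t) - q s))
    (𝓝[T \ {jump T t}] t) (𝓝 v)

/-- Absolute continuity of `q` on `[c,d]_T = [c,d] ∩ T`. -/
def IsAbsContOn {E : Type*} [NormedAddCommGroup E]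
    (T : Set ℝ) (c d : ℝ) (q : ℝ → E) : Prop :=
  ∀ ε : ℝ, 0 < ε → ∃ δ : ℝ, 0 < δ ∧
    ∀ (k : ℕ) (x y : Fin k → ℝ),
      (∀ i, x i ∈ T ∩ Set.Icc c d ∧ y i ∈ T ∩ Set.Icc c d ∧ x i ≤ y i) →
      Pairwise (fun i j => Disjoint (Set.Ico (x i) (y i)) (Set.Ico (x j) (y j))) →
      ∑ i, (y i - x i) < δ → ∑ i, ‖q (y i) - q (x i)‖ < ε

/-- The map `Φ : T → T₁`, `Φ(t) = sup {s ∈ T₁ | s ≤ t}`. -/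
def lastControlTime (T₁ : Set ℝ) (t : ℝ) : ℝ := sSup {s | s ∈ T₁ ∧ s ≤ t}

/-- `u ∈ L^∞_{T₁}(T₁, Ω)`. -/
def IsControl {m : ℕ} (T₁ : Set ℝ) (Ω : Set (EuclideanSpace ℝ (Fin m)))
    (u : ℝ → EuclideanSpace ℝ (Fin m)) : Prop :=
  MeasureTheory.MemLp u ∞ (deltaMeasure T₁) ∧ ∀ᵐ t ∂(deltaMeasure T₁), u t ∈ Ω

/-- The data of an optimal sampled-data control problem on time scales. Functions of time are
total functions on `ℝ`, of which only the values on `T` (for controls: on `T₁`) are used. -/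
structure OSDCP (n m j : ℕ) where
  /-- the time scale of the state -/
  T : Set ℝ
  /-- the time scale of the control -/
  T₁ : Set ℝ
  /-- the initial time -/
  a : ℝ
  /-- the dynamics -/
  f : ℝ → EuclideanSpace ℝ (Fin n) → EuclideanSpace ℝ (Fin m) → EuclideanSpace ℝ (Fin n)
  /-- the running cost -/
  f₀ : ℝ → EuclideanSpace ℝ (Fin n) → EuclideanSpace ℝ (Fin m) → ℝ
  /-- the set of pointwise constraints on the control -/
  Ω : Set (EuclideanSpace ℝ (Fin m))
  /-- the terminal map -/
  g : EuclideanSpace ℝ (Fin n) → EuclideanSpace ℝ (Fin n) → EuclideanSpace ℝ (Fin j)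
  /-- the terminal constraint set -/
  S : Set (EuclideanSpace ℝ (Fin j))
  /-- the allowed final times: `{b₀}` if the final time is fixed, `T` if it is free -/
  B : Set ℝ

namespace OSDCP

variable {n m j : ℕ}

/-- The standing assumptions on the data. -/
structure Standing (P : OSDCP n m j) : Prop where
  timeScale : IsTimeScale P.T P.a
  timeScale₁ : IsTimeScale P.T₁ P.a
  subset : P.T₁ ⊆ P.T
  continuousOn_f : ContinuousOn
    (fun z : ℝ × EuclideanSpace ℝ (Fin n) × EuclideanSpace ℝ (Fin m) => P.f z.1 z.2.1 z.2.2)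
    (P.T ×ˢ Set.univ)
  continuousOn_f₀ : ContinuousOn
    (fun z : ℝ × EuclideanSpace ℝ (Fin n) × EuclideanSpace ℝ (Fin m) => P.f₀ z.1 z.2.1 z.2.2)
    (P.T ×ˢ Set.univ)
  contDiff_f : ∀ t ∈ P.T, ContDiff ℝ 1
    (fun z : EuclideanSpace ℝ (Fin n) × EuclideanSpace ℝ (Fin m) => P.f t z.1 z.2)
  contDiff_f₀ : ∀ t ∈ P.T, ContDiff ℝ 1
    (fun z : EuclideanSpace ℝ (Fin n) × EuclideanSpace ℝ (Fin m) => P.f₀ t z.1 z.2)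
  continuous_g : Continuous
    (fun z : EuclideanSpace ℝ (Fin n) × EuclideanSpace ℝ (Fin n) => P.g z.1 z.2)
  nonempty_Ω : P.Ω.Nonempty
  isClosed_Ω : IsClosed P.Ω
  nonempty_S : P.S.Nonempty
  isClosed_S : IsClosed P.S
  convex_S : Convex ℝ P.S
  finalTime : P.B = P.T ∨ ∃ b₀ ∈ P.T, P.B = {b₀}

/-- `q`, defined on `[a,b]_T`, is an admissible trajectory (an element of the set `𝓜`) associated
with the final time `b` and the sampled-data control `u`. -/
structure IsAdmissible (P : OSDCP n m j) (b : ℝ) (u : ℝ → EuclideanSpace ℝ (Fin m))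
    (q : ℝ → EuclideanSpace ℝ (Fin n)) : Prop where
  finalTime_mem : b ∈ P.B
  control : IsControl P.T₁ P.Ω u
  absCont : IsAbsContOn P.T P.a b q
  dynamics : ∀ᵐ t ∂((deltaMeasure P.T).restrict (Set.Ico P.a b)),
    HasDeltaDerivAt P.T q (P.f t (q t) (u (lastControlTime P.T₁ t))) t
  terminal : P.g (q P.a) (q b) ∈ P.S

/-- The cost `∫_{[a,b)_T} f⁰(τ, q(τ), u^Φ(τ)) Δτ`. -/
def cost (P : OSDCP n m j) (b : ℝ) (u : ℝ → EuclideanSpace ℝ (Fin m))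
    (q : ℝ → EuclideanSpace ℝ (Fin n)) : ℝ :=
  ∫ τ in Set.Ico P.a b, P.f₀ τ (q τ) (u (lastControlTime P.T₁ τ)) ∂(deltaMeasure P.T)

/-- Optimal solutions: admissible, with minimal cost among all admissible trajectories. -/
def IsOptimal (P : OSDCP n m j) (b : ℝ) (u : ℝ → EuclideanSpace ℝ (Fin m))
    (q : ℝ → EuclideanSpace ℝ (Fin n)) : Prop :=
  P.IsAdmissible b u q ∧
    ∀ (b' : ℝ) (u' : ℝ → EuclideanSpace ℝ (Fin m)) (q' : ℝ → EuclideanSpace ℝ (Fin n)),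
      P.IsAdmissible b' u' q' → P.cost b u q ≤ P.cost b' u' q'

/-- The set `𝓦(t,q)` of extended velocities. -/
def extendedVelocities (P : OSDCP n m j) (t : ℝ) (x : EuclideanSpace ℝ (Fin n)) :
    Set (EuclideanSpace ℝ (Fin n) × ℝ) :=
  (fun v => (P.f t x v, P.f₀ t x v)) '' P.Ω

end OSDCP

end TimeScale

end

/-! Write `φ` and `φ₁` for the projections of real time onto the last preceding point of `T` and of
`T₁`. The Lebesgue `Δ`-measure is the image of Lebesgue measure on `[a, ∞)` under `φ`
(`map_lastControlTime`), because `φ` is the identity on `T` and collapses each gap onto its left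
end. Since `φ₁ ∘ φ = φ₁`, the whole problem becomes one in real time: an admissible trajectory
paired with its running cost is the restriction to `T` of a curve `y` in `ℝⁿ × ℝ` that is the
integral of `(f, f⁰)` evaluated at projected times. Compactness of `Ω` and the a priori bound give
all these curves one Lipschitz constant (`IsAdmissible.exists_extension`). The passage between
`Δ`-derivatives and integrals is the fundamental theorem of calculus on `T`, in both directions
(`IsAbsContOn.eq_add_integral`, `IsTimeScale.ae_hasDeltaDerivAt`).

Along a minimizing sequence, take limits along a non-principal ultrafilter on `ℕ`: the final times
and the curves at every time converge, and the limit `z` is again Lipschitz, hence differentiable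
almost everywhere. Its derivative at `t` is a limit of averages of velocities near `t`, so it lies
in any closed convex set that these velocities approach (`mem_of_hasDerivAt_of_tendsto`). That set
is chosen in two ways in `exists_control_of_limit`. If `t` lies in a gap of `T₁`, the controls are
frozen at their value at the left end `r`; these values converge in `Ω`, so the set is the single
velocity given by their limit. This yields one control value for the entire gap, which a selection
made separately at each time would not. Otherwise `t ∈ T₁`, the set is that of all extended
velocities, and Filippov's measurable selection supplies the control. The limit is then admissible,
and its cost is the infimum because the cost is a coordinate of the curve. -/

namespace TimeScale

open MeasureTheory Set Filter

variable {T T₁ : Set ℝ} {a b t s r : ℝ}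

/-! ### The projection onto a time scale, and the `Δ`-measure as an image measure -/

namespace IsTimeScale

lemma le_of_mem (hT : IsTimeScale T a) (ht : t ∈ T) : a ≤ t := hT.isLeast.2 ht

lemma exists_gt (hT : IsTimeScale T a) (t : ℝ) : ∃ s ∈ T, t < s := by
  by_contra! h
  exact hT.not_bddAbove ⟨t, h⟩

lemma lastControlTime_mem (hT : IsTimeScale T a) (ht : a ≤ t) : lastControlTime T t ∈ T := by
  have hc : IsClosed {s | s ∈ T ∧ s ≤ t} := hT.isClosed.inter isClosed_Iic
  exact (hc.csSup_mem ⟨a, hT.isLeast.1, ht⟩ ⟨t, fun s hs => hs.2⟩).1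

lemma lastControlTime_le (hT : IsTimeScale T a) (ht : a ≤ t) : lastControlTime T t ≤ t :=
  csSup_le ⟨a, hT.isLeast.1, ht⟩ fun _ hs => hs.2

lemma le_lastControlTime (hs : s ∈ T) (hst : s ≤ t) : s ≤ lastControlTime T t :=
  le_csSup ⟨t, fun _ hs => hs.2⟩ ⟨hs, hst⟩

lemma lastControlTime_of_mem (hT : IsTimeScale T a) (ht : t ∈ T) : lastControlTime T t = t :=
  le_antisymm (hT.lastControlTime_le (hT.le_of_mem ht)) (le_lastControlTime ht le_rfl)

lemma le_lastControlTime_self (hT : IsTimeScale T a) (ht : a ≤ t) : a ≤ lastControlTime T t :=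
  le_lastControlTime hT.isLeast.1 ht

lemma lastControlTime_mono (hT : IsTimeScale T a) (hs : a ≤ s) (hst : s ≤ t) :
    lastControlTime T s ≤ lastControlTime T t :=
  le_lastControlTime (hT.lastControlTime_mem hs) ((hT.lastControlTime_le hs).trans hst)

lemma jump_mem (hT : IsTimeScale T a) (t : ℝ) : jump T t ∈ T := by
  have hne : {s | s ∈ T ∧ t < s}.Nonempty := (hT.exists_gt t)
  have hb : BddBelow {s | s ∈ T ∧ t < s} := ⟨t, fun s hs => hs.2.le⟩
  have := csInf_mem_closure hne hb
  exact closure_minimal (fun s hs => hs.1) hT.isClosed this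

lemma le_jump (hT : IsTimeScale T a) (t : ℝ) : t ≤ jump T t :=
  le_csInf (hT.exists_gt t) fun _ hs => hs.2.le

lemma jump_le (hs : s ∈ T) (hts : t < s) : jump T t ≤ s :=
  csInf_le ⟨t, fun _ hs => hs.2.le⟩ ⟨hs, hts⟩

lemma jump_eq_self (hT : IsTimeScale T a) (ht : t ∈ T) (h : t ∉ rightScattered T) :
    jump T t = t :=
  le_antisymm (not_lt.1 fun hlt => h ⟨ht, hlt⟩) (hT.le_jump t)

lemma lastControlTime_eq_of_mem_Ico (hT : IsTimeScale T a) (hr : r ∈ T)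
    (ht : t ∈ Ico r (jump T r)) : lastControlTime T t = r := by
  have hat : a ≤ t := (hT.le_of_mem hr).trans ht.1
  refine le_antisymm ?_ (le_lastControlTime hr ht.1)
  by_contra! h
  exact absurd ((jump_le (hT.lastControlTime_mem hat) h).trans (hT.lastControlTime_le hat))
    (not_le.2 ht.2)

lemma lt_jump_lastControlTime (hT : IsTimeScale T a) (ht : a ≤ t) (htT : t ∉ T) :
    lastControlTime T t < t ∧ t < jump T (lastControlTime T t) := by
  have h1 : lastControlTime T t < t := lt_of_le_of_ne (hT.lastControlTime_le ht)
    fun h => htT (h ▸ hT.lastControlTime_mem ht)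
  refine ⟨h1, ?_⟩
  -- Otherwise the jump, being a point of `T` not beyond `t`, equals the projection itself. The
  -- projection is then right-dense, so `T` has points between it and `t`, against its maximality.
  by_contra! h
  have h2 := le_lastControlTime (hT.jump_mem _) h
  have h3 := hT.le_jump (lastControlTime T t)
  have h4 : jump T (lastControlTime T t) = lastControlTime T t := le_antisymm h2 h3
  have hne : {s | s ∈ T ∧ lastControlTime T t < s}.Nonempty := (hT.exists_gt _)
  have : sInf {s | s ∈ T ∧ lastControlTime T t < s} < t := by
    change jump T _ < t
    rwa [h4]
  obtain ⟨s, hs, hst⟩ := exists_lt_of_csInf_lt hne this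
  exact absurd (le_lastControlTime hs.1 hst.le) (not_le.2 hs.2)

lemma lastControlTime_mem_rightScattered (hT : IsTimeScale T a) (ht : a ≤ t) (htT : t ∉ T) :
    lastControlTime T t ∈ rightScattered T :=
  ⟨hT.lastControlTime_mem ht,
    (hT.lt_jump_lastControlTime ht htT).1.trans (hT.lt_jump_lastControlTime ht htT).2⟩

lemma mem_Ico_lastControlTime (hT : IsTimeScale T a) (ht : a ≤ t)
    (h : lastControlTime T t ∈ rightScattered T) :
    t ∈ Ico (lastControlTime T t) (jump T (lastControlTime T t)) := by
  refine ⟨hT.lastControlTime_le ht, ?_⟩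
  by_cases htT : t ∈ T
  · rw [hT.lastControlTime_of_mem htT] at h ⊢
    exact h.2
  · exact (hT.lt_jump_lastControlTime ht htT).2

lemma mem_of_lastControlTime_notMem (hT : IsTimeScale T a) (ht : a ≤ t)
    (h : lastControlTime T t ∉ rightScattered T) : t ∈ T := by
  by_contra htT
  exact h (hT.lastControlTime_mem_rightScattered ht htT)

/-- The last point of `T₁` before `t` belongs to `T`, so it already precedes the projection of `t`
onto `T`. This lets a sampled control be read directly in real time. -/
lemma lastControlTime_comp (hT : IsTimeScale T a) (hT₁ : IsTimeScale T₁ a) (hsub : T₁ ⊆ T)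
    (ht : a ≤ t) : lastControlTime T₁ (lastControlTime T t) = lastControlTime T₁ t := by
  have h1 := hT.le_lastControlTime_self ht
  refine le_antisymm (hT₁.lastControlTime_mono h1 (hT.lastControlTime_le ht)) ?_
  exact le_lastControlTime (hT₁.lastControlTime_mem ht)
    (le_lastControlTime (hsub (hT₁.lastControlTime_mem ht)) (hT₁.lastControlTime_le ht))

lemma pairwiseDisjoint_Ico_jump (T : Set ℝ) :
    (rightScattered T).PairwiseDisjoint fun r => Ico r (jump T r) := by
  intro r hr s hs hrs
  wlog h : r < s generalizing r s
  · exact (this hs hr hrs.symm (lt_of_le_of_ne (not_lt.1 h) hrs.symm)).symm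
  rw [Function.onFun, Set.disjoint_left]
  intro x hx hx'
  exact absurd (hx'.1.trans_lt hx.2) (not_lt.2 (jump_le hs.1 h))

lemma countable_rightScattered (T : Set ℝ) : (rightScattered T).Countable :=
  Set.PairwiseDisjoint.countable_of_Ioo (y := jump T)
    ((pairwiseDisjoint_Ico_jump T).mono_on fun _ _ => Ioo_subset_Ico_self) fun _ hr => hr.2

lemma monotoneOn_lastControlTime (hT : IsTimeScale T a) :
    MonotoneOn (lastControlTime T) (Ici a) :=
  fun _ hs _ _ hst => hT.lastControlTime_mono hs hst

lemma aemeasurable_lastControlTime (hT : IsTimeScale T a) :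
    AEMeasurable (lastControlTime T) (volume.restrict (Ici a)) :=
  aemeasurable_restrict_of_monotoneOn measurableSet_Ici hT.monotoneOn_lastControlTime

/-- The Lebesgue `Δ`-measure is the image of the Lebesgue measure of `[a, ∞)` under
`t ↦ sup {s ∈ T | s ≤ t}`. -/
theorem map_lastControlTime (hT : IsTimeScale T a) :
    (volume.restrict (Ici a)).map (lastControlTime T) = deltaMeasure T := by
  have hcount := countable_rightScattered T
  have : Countable (rightScattered T) := hcount.to_subtype
  ext A hA
  have hTm := hT.isClosed.measurableSet
  have hRS : MeasurableSet (rightScattered T) := hcount.measurableSet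
  rw [Measure.map_apply_of_aemeasurable hT.aemeasurable_lastControlTime hA,
    Measure.restrict_apply' measurableSet_Ici]
  -- The preimage splits into the right-dense points of `A`, which are fixed, and whole gaps over
  -- the right-scattered points of `A`, whose lengths are the graininesses.
  have hset : lastControlTime T ⁻¹' A ∩ Ici a =
      (A ∩ (T \ rightScattered T)) ∪
        ⋃ r : rightScattered T, {x | (r : ℝ) ∈ A ∧ x ∈ Ico (r : ℝ) (jump T r)} := by
    ext x
    simp only [mem_inter_iff, mem_preimage, mem_Ici, mem_union, Set.mem_sdiff, mem_iUnion,
      mem_ofPred_eq]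
    constructor
    · rintro ⟨h1, h2⟩
      by_cases h : lastControlTime T x ∈ rightScattered T
      · exact Or.inr ⟨⟨_, h⟩, h1, hT.mem_Ico_lastControlTime h2 h⟩
      · have hx := hT.mem_of_lastControlTime_notMem h2 h
        rw [hT.lastControlTime_of_mem hx] at h h1
        exact Or.inl ⟨h1, hx, h⟩
    · rintro (⟨h1, h2, h3⟩ | ⟨⟨r, hr⟩, h1, h2⟩)
      · rw [hT.lastControlTime_of_mem h2]
        exact ⟨h1, hT.le_of_mem h2⟩
      · rw [hT.lastControlTime_eq_of_mem_Ico hr.1 h2]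
        exact ⟨h1, (hT.le_of_mem hr.1).trans h2.1⟩
  have hm : ∀ r : rightScattered T,
      MeasurableSet {x | (r : ℝ) ∈ A ∧ x ∈ Ico (r : ℝ) (jump T r)} := fun r =>
    (MeasurableSet.const _).inter measurableSet_Ico
  rw [hset, measure_union _ (MeasurableSet.iUnion hm), measure_iUnion _ hm]
  · have h1 : volume (A ∩ (T \ rightScattered T)) = volume (A ∩ T) := by
      rw [← inter_sdiff_assoc]
      exact measure_sdiff_null (hcount.measure_zero _)
    rw [h1, deltaMeasure, Measure.add_apply, Measure.restrict_apply hA, Measure.sum_apply _ hA]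
    congr 1
    refine tsum_congr fun r => ?_
    by_cases hr : (r : ℝ) ∈ A
    · simp [hr, graininess, Measure.dirac_apply' _ hA, Ico_def]
    · simp [hr, Measure.dirac_apply' _ hA]
  · intro r s hrs
    have := pairwiseDisjoint_Ico_jump T r.2 s.2 (fun h => hrs (Subtype.ext h))
    exact this.mono (fun x hx => hx.2) (fun x hx => hx.2)
  · rw [Set.disjoint_left]
    rintro x ⟨_, hx1, hx2⟩ hx
    obtain ⟨⟨r, hr⟩, h1, h2⟩ := mem_iUnion.1 hx
    have := hT.lastControlTime_eq_of_mem_Ico hr.1 h2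
    rw [hT.lastControlTime_of_mem hx1] at this
    exact hx2 (this ▸ hr)

/-- Right-scattered points are atoms of positive mass, so an almost everywhere property holds at
each of them without exception. -/
lemma ae_deltaMeasure_iff (T : Set ℝ) {p : ℝ → Prop} :
    (∀ᵐ t ∂(deltaMeasure T), p t) ↔
      (∀ᵐ t ∂(volume.restrict T), p t) ∧ ∀ r ∈ rightScattered T, p r := by
  have : Countable (rightScattered T) := (countable_rightScattered T).to_subtype
  rw [deltaMeasure, ae_add_measure_iff, Measure.ae_sum_iff]
  refine and_congr_right fun _ => ?_
  rw [Subtype.forall]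
  refine forall₂_congr fun r hr => ?_
  have : ENNReal.ofReal (graininess T r) ≠ 0 := by
    simpa [graininess] using hr.2
  rw [Measure.ae_ennreal_smul_measure_iff this, ae_dirac_eq]
  rfl

/-- A property that holds `Δ`-a.e. holds Lebesgue-a.e. after composition with the projection. -/
lemma ae_comp_lastControlTime (hT : IsTimeScale T a) {p : ℝ → Prop}
    (h : ∀ᵐ t ∂(deltaMeasure T), p t) : ∀ᵐ s, a ≤ s → p (lastControlTime T s) := by
  rw [← hT.map_lastControlTime] at h
  exact (ae_restrict_iff' measurableSet_Ici).1 (ae_of_ae_map hT.aemeasurable_lastControlTime h)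

lemma lastControlTime_lt_iff (hT : IsTimeScale T a) (hs : a ≤ s) (ht : t ∈ T) :
    lastControlTime T s < t ↔ s < t :=
  ⟨fun h => not_le.1 fun h' => absurd (le_lastControlTime ht h') (not_le.2 h),
    fun h => (hT.lastControlTime_le hs).trans_lt h⟩

/-- The projection onto a time scale is right-continuous. -/
lemma eventually_lastControlTime (hT : IsTimeScale T a) (ht : a ≤ t) {δ : ℝ} (hδ : 0 < δ) :
    ∃ η > 0, ∀ s ∈ Ico t (t + η),
      lastControlTime T t ≤ lastControlTime T s ∧
      lastControlTime T s < lastControlTime T t + δ := by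
  by_cases htT : t ∈ T
  · refine ⟨δ, hδ, fun s hs => ?_⟩
    have h1 := hT.lastControlTime_le (ht.trans hs.1)
    have h2 := hT.lastControlTime_mono ht hs.1
    rw [hT.lastControlTime_of_mem htT] at h2 ⊢
    exact ⟨h2, h1.trans_lt hs.2⟩
  · obtain ⟨h1, h2⟩ := hT.lt_jump_lastControlTime ht htT
    refine ⟨jump T (lastControlTime T t) - t, by linarith, fun s hs => ?_⟩
    have : lastControlTime T s = lastControlTime T t :=
      hT.lastControlTime_eq_of_mem_Ico (hT.lastControlTime_mem ht)
        ⟨h1.le.trans hs.1, by linarith [hs.2]⟩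
    rw [this]
    exact ⟨le_rfl, by linarith⟩

end IsTimeScale

/-! ### Calculus on a time scale -/

open IsTimeScale

variable {E : Type*} [NormedAddCommGroup E] [NormedSpace ℝ E]
variable {C : ℝ} {q v : ℝ → E}

lemma hasDeltaDerivAt_iff_hasDerivWithinAt {w : E} (h : jump T t = t) :
    HasDeltaDerivAt T q w t ↔ HasDerivWithinAt q w T t := by
  rw [HasDeltaDerivAt, hasDerivWithinAt_iff_tendsto_slope, h]
  refine tendsto_congr fun s => ?_
  rw [slope_def_module, ← neg_sub s t, ← neg_sub (q s), inv_neg, neg_smul_neg]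

/-- At a right-scattered point the limit defining the `Δ`-derivative runs over a set containing `r`
itself, so it can only be the quotient at `s = r`. -/
lemma HasDeltaDerivAt.jump_sub {w : E} (h : HasDeltaDerivAt T q w r) (hr : r ∈ rightScattered T) :
    q (jump T r) - q r = (jump T r - r) • w := by
  have hmem : r ∈ T \ {jump T r} := ⟨hr.1, hr.2.ne⟩
  have h1 := tendsto_nhds_unique (h.mono_left (pure_le_nhdsWithin hmem))
    (tendsto_pure_nhds _ _)
  rw [h1, smul_inv_smul₀ (sub_pos.2 hr.2).ne']

lemma hasDeltaDerivAt_of_jump_sub {w : E} (hr : r ∈ rightScattered T)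
    (hq : ContinuousWithinAt q T r) (h : q (jump T r) - q r = (jump T r - r) • w) :
    HasDeltaDerivAt T q w r := by
  have h0 := (sub_pos.2 hr.2).ne'
  have h1 : w = (jump T r - r)⁻¹ • (q (jump T r) - q r) := by rw [h, inv_smul_smul₀ h0]
  rw [h1]
  have : ContinuousWithinAt (fun s : ℝ => (jump T r - s)⁻¹ • (q (jump T r) - q s)) T r :=
    ((continuousWithinAt_const.sub continuousWithinAt_id).inv₀ h0).smul
      (continuousWithinAt_const.sub hq)
  exact this.mono sdiff_subset

lemma IsTimeScale.integral_comp_lastControlTime_jump [CompleteSpace E]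
    (hT : IsTimeScale T a) (hr : r ∈ T) :
    ∫ s in r..jump T r, v (lastControlTime T s) = (jump T r - r) • v r := by
  rw [← intervalIntegral.integral_const]
  refine intervalIntegral.integral_congr_ae ?_
  have : ∀ᵐ s : ℝ, s ≠ jump T r := by simp [ae_iff]
  filter_upwards [this] with s hs hs'
  rw [uIoc_of_le (hT.le_jump r)] at hs'
  rw [hT.lastControlTime_eq_of_mem_Ico hr ⟨hs'.1.le, lt_of_le_of_ne hs'.2 hs⟩]

-- When `D` agrees at both ends of every gap, a point inside a gap may be moved to the right end
-- instead of the left. Choosing the side keeps the new point inside a given interval, so distances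
-- do not grow.
omit [NormedAddCommGroup E] [NormedSpace ℝ E] in
lemma IsTimeScale.exists_comp_lastControlTime_eq (hT : IsTimeScale T a) {D : ℝ → E} {x : ℝ}
    (hx : x ∈ Icc a b)
    (hD : ∀ r ∈ rightScattered T, r ∈ Ico a b → D (jump T r) = D r) :
    ∃ z ∈ T, x ≤ z ∧ D (lastControlTime T x) = D z ∧ ∀ s ∈ T, x ≤ s → z ≤ s := by
  by_cases hxT : x ∈ T
  · exact ⟨x, hxT, le_rfl, by rw [hT.lastControlTime_of_mem hxT], fun _ _ h => h⟩
  · obtain ⟨h1, h2⟩ := hT.lt_jump_lastControlTime hx.1 hxT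
    refine ⟨_, hT.jump_mem (lastControlTime T x), h2.le, (hD _
      (hT.lastControlTime_mem_rightScattered hx.1 hxT)
      ⟨hT.le_lastControlTime_self hx.1, h1.trans_le hx.2⟩).symm, fun s hs hxs =>
        jump_le hs (h1.trans_le hxs)⟩

-- An interval `[x, y]` of real time is shrunk to `[z, w]`, from the first point of `T` after `x` to
-- the last one before `y`. The increment of `D` is unchanged and disjointness is kept, so the
-- modulus `δ` on `T` serves on the real interval too.
omit [NormedSpace ℝ E] in
lemma IsAbsContOn.comp_lastControlTime (hT : IsTimeScale T a) {D : ℝ → E} (hb : b ∈ T)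
    (hD : IsAbsContOn T a b D)
    (hjump : ∀ r ∈ rightScattered T, r ∈ Ico a b → D (jump T r) = D r) :
    AbsolutelyContinuousOnInterval (D ∘ lastControlTime T) a b := by
  have hab := hT.le_of_mem hb
  rw [absolutelyContinuousOnInterval_iff]
  intro ε hε
  obtain ⟨δ, hδ, H⟩ := hD ε hε
  refine ⟨δ, hδ, ?_⟩
  rintro ⟨k, I⟩ ⟨hI, hdisj⟩ hsum
  simp only [Finset.mem_range, uIcc_of_le hab] at hI hsum ⊢
  have key : ∀ i : Fin k, ∃ z w : ℝ, z ∈ T ∩ Icc a b ∧ w ∈ T ∩ Icc a b ∧ z ≤ w ∧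
      Ico z w ⊆ Ico (min (I i).1 (I i).2) (max (I i).1 (I i).2) ∧
      w - z ≤ dist (I i).1 (I i).2 ∧
      dist (D (lastControlTime T (I i).1)) (D (lastControlTime T (I i).2)) = ‖D w - D z‖ := by
    intro i
    have main : ∀ x y : ℝ, x ∈ Icc a b → y ∈ Icc a b → x ≤ y →
        ∃ z w : ℝ, z ∈ T ∩ Icc a b ∧ w ∈ T ∩ Icc a b ∧ z ≤ w ∧ Ico z w ⊆ Ico x y ∧
        w - z ≤ y - x ∧
        ‖D (lastControlTime T y) - D (lastControlTime T x)‖ = ‖D w - D z‖ := by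
      intro x y hx hy hxy
      obtain ⟨z, hz, hxz, hDz, hzmin⟩ := hT.exists_comp_lastControlTime_eq hx hjump
      have hzb : z ∈ T ∩ Icc a b := ⟨hz, hx.1.trans hxz, hzmin b hb hx.2⟩
      have hφy := hT.lastControlTime_mem hy.1
      have hφy' := hT.lastControlTime_le hy.1
      rcases le_or_gt z (lastControlTime T y) with h | h
      · exact ⟨z, lastControlTime T y, hzb, ⟨hφy, hT.le_of_mem hφy, hφy'.trans hy.2⟩, h,
          Ico_subset_Ico hxz hφy', by linarith, by rw [hDz]⟩
      -- No point of `T` lies in `[x, y]`: both ends are in one gap, the increment vanishes, and a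
      -- degenerate interval will do.
      · refine ⟨z, z, hzb, hzb, le_rfl, by simp, by linarith, ?_⟩
        have h1 : lastControlTime T y < x := by
          by_contra! h'
          exact absurd (hzmin _ hφy h') (not_le.2 h)
        have h2 : lastControlTime T y = lastControlTime T x :=
          le_antisymm (le_lastControlTime hφy h1.le) (hT.lastControlTime_mono hx.1 hxy)
        simp [h2]
    rcases le_total (I i).1 (I i).2 with h | h
    · obtain ⟨z, w, h1, h2, h3, h4, h5, h6⟩ := main _ _ (hI i i.2).1 (hI i i.2).2 h
      refine ⟨z, w, h1, h2, h3, ?_, ?_, ?_⟩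
      · rwa [min_eq_left h, max_eq_right h]
      · rwa [Real.dist_eq, abs_sub_comm, abs_of_nonneg (sub_nonneg.2 h)]
      · rw [dist_comm, dist_eq_norm, h6]
    · obtain ⟨z, w, h1, h2, h3, h4, h5, h6⟩ := main _ _ (hI i i.2).2 (hI i i.2).1 h
      refine ⟨z, w, h1, h2, h3, ?_, ?_, ?_⟩
      · rwa [min_eq_right h, max_eq_left h]
      · rwa [Real.dist_eq, abs_of_nonneg (sub_nonneg.2 h)]
      · rw [dist_eq_norm, h6]
  choose z w hz hw hzw hsub hlen hdist using key
  rw [Finset.sum_range] at hsum ⊢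
  simp only [Function.comp_apply, hdist]
  refine H k z w (fun i => ⟨hz i, hw i, hzw i⟩) ?_
    ((Finset.sum_le_sum fun i _ => hlen i).trans_lt hsum)
  intro i j hij
  have h1 := hdisj (Finset.mem_coe.2 (Finset.mem_range.2 i.2))
    (Finset.mem_coe.2 (Finset.mem_range.2 j.2)) (fun h => hij (Fin.ext h))
  refine Disjoint.mono (hsub i) (hsub j) ?_
  simp only [Function.onFun, uIoc] at h1
  rw [Ioc_disjoint_Ioc] at h1
  rwa [Ico_disjoint_Ico]

/-- Each nearby `s` can be replaced by a point `z` of `T` between `s` and `t` with the same value of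
`D`, so an error `o(|z - t|)` is also `o(|s - t|)`. -/
lemma HasDerivWithinAt.comp_lastControlTime (hT : IsTimeScale T a) {D : ℝ → E}
    (hjump : ∀ r ∈ rightScattered T, r ∈ Ico a b → D (jump T r) = D r)
    (ht : t ∈ Ioo a b) (htT : t ∈ T) (hd : HasDerivWithinAt D 0 T t) :
    HasDerivAt (D ∘ lastControlTime T) 0 t := by
  rw [hasDerivAt_iff_isLittleO, Asymptotics.isLittleO_iff]
  rw [hasDerivWithinAt_iff_isLittleO, Asymptotics.isLittleO_iff] at hd
  intro c hc
  obtain ⟨η, hη, hball⟩ := Metric.mem_nhdsWithin_iff.1 (hd hc)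
  filter_upwards [Ioo_mem_nhds ht.1 ht.2, Metric.ball_mem_nhds t hη] with s hs hsη
  rw [Metric.mem_ball, Real.dist_eq] at hsη
  have key : ∃ z ∈ T, |z - t| ≤ |s - t| ∧ D (lastControlTime T s) = D z := by
    rcases le_total t s with h | h
    · refine ⟨_, hT.lastControlTime_mem hs.1.le, ?_, rfl⟩
      have h1 := le_lastControlTime htT h
      have h2 := hT.lastControlTime_le hs.1.le
      rw [abs_of_nonneg (by linarith), abs_of_nonneg (by linarith)]
      linarith
    · obtain ⟨z, hz, hsz, hDz, hmin⟩ :=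
        hT.exists_comp_lastControlTime_eq ⟨hs.1.le, hs.2.le⟩ hjump
      refine ⟨z, hz, ?_, hDz⟩
      have h1 := hmin t htT h
      rw [abs_of_nonpos (by linarith), abs_of_nonpos (by linarith)]
      linarith
  obtain ⟨z, hz, hzs, hDz⟩ := key
  have h1 : z ∈ Metric.ball t η ∩ T := ⟨by rw [Metric.mem_ball, Real.dist_eq]; linarith, hz⟩
  have h2 := hball h1
  simp only [mem_ofPred_eq, smul_zero, sub_zero, Real.norm_eq_abs] at h2
  simp only [Function.comp_apply, smul_zero, sub_zero, Real.norm_eq_abs, hDz,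
    hT.lastControlTime_of_mem htT]
  exact h2.trans (mul_le_mul_of_nonneg_left hzs hc.le)

lemma norm_integral_sub_le {w : ℝ → E} {x y : ℝ} (hw : IntervalIntegrable w volume a b)
    (hC : ∀ᵐ s, s ∈ Ico a b → ‖w s‖ ≤ C) (hx : x ∈ Icc a b) (hy : y ∈ Icc a b) (hxy : x ≤ y) :
    ‖(∫ s in a..y, w s) - ∫ s in a..x, w s‖ ≤ C * (y - x) := by
  have hab : a ≤ b := hx.1.trans hx.2
  have hsub : ∀ z ∈ Icc a b, IntervalIntegrable w volume a z := fun z hz =>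
    hw.mono_set (by rw [uIcc_of_le hab, uIcc_of_le hz.1]; exact Icc_subset_Icc_right hz.2)
  rw [intervalIntegral.integral_interval_sub_left (hsub y hy) (hsub x hx)]
  have := intervalIntegral.norm_integral_le_of_norm_le_const_ae (f := w) (a := x) (b := y) (C := C)
    (by
      have hne : ∀ᵐ s : ℝ, s ≠ b := by simp [ae_iff]
      filter_upwards [hC, hne] with s hs hsb hs'
      rw [uIoc_of_le hxy] at hs'
      exact hs ⟨hx.1.trans hs'.1.le, lt_of_le_of_ne (hs'.2.trans hy.2) hsb⟩)
  rwa [abs_of_nonneg (sub_nonneg.2 hxy)] at this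

omit [NormedSpace ℝ E] in
lemma isAbsContOn_of_norm_sub_le {D : ℝ → E}
    (h : ∀ x ∈ T ∩ Icc a b, ∀ y ∈ T ∩ Icc a b, x ≤ y → ‖D y - D x‖ ≤ C * (y - x)) :
    IsAbsContOn T a b D := by
  intro ε hε
  refine ⟨ε / (|C| + 1), by positivity, fun k x y hxy _ hsum => ?_⟩
  calc ∑ i, ‖D (y i) - D (x i)‖ ≤ ∑ i, (|C| + 1) * (y i - x i) := by
        refine Finset.sum_le_sum fun i _ => ?_
        obtain ⟨h1, h2, h3⟩ := hxy i
        refine (h _ h1 _ h2 h3).trans (mul_le_mul_of_nonneg_right ?_ (sub_nonneg.2 h3))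
        linarith [le_abs_self C]
    _ = (|C| + 1) * ∑ i, (y i - x i) := by rw [Finset.mul_sum]
    _ < ε := by
        rw [lt_div_iff₀' (by positivity)] at hsum
        exact hsum

omit [NormedSpace ℝ E] in
lemma IsAbsContOn.sub {D F : ℝ → E} (hD : IsAbsContOn T a b D) (hF : IsAbsContOn T a b F) :
    IsAbsContOn T a b (fun t => D t - F t) := by
  intro ε hε
  obtain ⟨δ₁, hδ₁, H₁⟩ := hD (ε / 2) (half_pos hε)
  obtain ⟨δ₂, hδ₂, H₂⟩ := hF (ε / 2) (half_pos hε)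
  refine ⟨min δ₁ δ₂, lt_min hδ₁ hδ₂, fun k x y hxy hdisj hsum => ?_⟩
  have h1 := H₁ k x y hxy hdisj (hsum.trans_le (min_le_left _ _))
  have h2 := H₂ k x y hxy hdisj (hsum.trans_le (min_le_right _ _))
  calc ∑ i, ‖D (y i) - F (y i) - (D (x i) - F (x i))‖
      ≤ ∑ i, (‖D (y i) - D (x i)‖ + ‖F (y i) - F (x i)‖) := by
        refine Finset.sum_le_sum fun i _ => ?_
        rw [sub_sub_sub_comm]
        exact norm_sub_le _ _
    _ < ε := by rw [Finset.sum_add_distrib]; linarith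

omit [NormedSpace ℝ E] in
lemma IsAbsContOn.continuousOn (h : IsAbsContOn T a b q) : ContinuousOn q (T ∩ Icc a b) := by
  rw [Metric.continuousOn_iff]
  intro x hx ε hε
  obtain ⟨δ, hδ, H⟩ := h ε hε
  refine ⟨δ, hδ, fun y hy hyx => ?_⟩
  have key : ∀ x ∈ T ∩ Icc a b, ∀ y ∈ T ∩ Icc a b, x ≤ y → dist y x < δ → dist (q y) (q x) < ε := by
    intro x hx y hy hxy hd
    have := H 1 (fun _ => x) (fun _ => y) (fun _ => ⟨hx, hy, hxy⟩)
      (fun i j hij => absurd (Subsingleton.elim i j) hij)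
      (by simpa using (le_abs_self _).trans_lt (by rwa [Real.dist_eq] at hd))
    simpa [dist_eq_norm] using this
  rcases le_total x y with h | h
  · exact key x hx y hy h hyx
  · rw [dist_comm] at hyx ⊢
    exact key y hy x hx h hyx

lemma IsTimeScale.ae_restrict_Ico_iff (hT : IsTimeScale T a) {p : ℝ → Prop} :
    (∀ᵐ t ∂((deltaMeasure T).restrict (Ico a b)), p t) ↔
      (∀ᵐ t, t ∈ T → t ∈ Ico a b → p t) ∧ ∀ r ∈ rightScattered T, r ∈ Ico a b → p r := by
  rw [ae_restrict_iff' measurableSet_Ico, ae_deltaMeasure_iff,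
    ae_restrict_iff' hT.isClosed.measurableSet]

/-- Fundamental theorem of calculus on a time scale: an absolutely continuous function with
bounded `Δ`-derivative is the integral of that derivative. -/
theorem IsAbsContOn.eq_add_integral [CompleteSpace E] (hT : IsTimeScale T a) (hb : b ∈ T)
    (hq : IsAbsContOn T a b q)
    (hv : IntervalIntegrable (fun s => v (lastControlTime T s)) volume a b)
    (hC : ∀ᵐ s, s ∈ Ico a b → ‖v (lastControlTime T s)‖ ≤ C)
    (hd : ∀ᵐ t ∂((deltaMeasure T).restrict (Ico a b)), HasDeltaDerivAt T q (v t) t) :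
    ∀ t ∈ T ∩ Icc a b, q t = q a + ∫ s in a..t, v (lastControlTime T s) := by
  have hab := hT.le_of_mem hb
  obtain ⟨hdd, hds⟩ := hT.ae_restrict_Ico_iff.1 hd
  set F : ℝ → E := fun t => ∫ s in a..t, v (lastControlTime T s) with hF
  have hint : ∀ z ∈ Icc a b,
      IntervalIntegrable (fun s => v (lastControlTime T s)) volume a z := fun z hz =>
    hv.mono_set (by rw [uIcc_of_le hab, uIcc_of_le hz.1]; exact Icc_subset_Icc_right hz.2)
  have hDac : IsAbsContOn T a b (fun t => q t - F t) :=
    hq.sub (isAbsContOn_of_norm_sub_le (C := C) fun x hx y hy hxy =>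
      norm_integral_sub_le hv hC hx.2 hy.2 hxy)
  -- Across a gap, `q` and the primitive `F` both grow by the graininess times `v r`, so `q - F`
  -- extends to real time, constant on gaps, without creating jumps.
  have hjump : ∀ r ∈ rightScattered T, r ∈ Ico a b →
      (fun t => q t - F t) (jump T r) = (fun t => q t - F t) r := by
    intro r hr hrab
    have h1 := (hds r hr hrab).jump_sub hr
    have h2 : F (jump T r) - F r = (jump T r - r) • v r := by
      rw [← hT.integral_comp_lastControlTime_jump hr.1, hF]
      exact intervalIntegral.integral_interval_sub_left
        (hint _ ⟨hrab.1.trans (hT.le_jump r), jump_le hb hrab.2⟩) (hint _ ⟨hrab.1, hrab.2.le⟩)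
    change q _ - F _ = q _ - F _
    rw [sub_eq_sub_iff_sub_eq_sub, h1, h2]
  have hac := hDac.comp_lastControlTime hT hb hjump
  -- At almost every point of `T` the two derivatives cancel by Lebesgue differentiation; off `T`
  -- the extension is locally constant.
  have hzero : ∀ᵐ x, x ∈ uIcc a b →
      HasDerivAt ((fun t => q t - F t) ∘ lastControlTime T) 0 x := by
    have hne : ∀ c : ℝ, ∀ᵐ s : ℝ, s ≠ c := fun c => by simp [ae_iff]
    have hRS : ∀ᵐ s : ℝ, s ∉ rightScattered T :=
      (IsTimeScale.countable_rightScattered T).ae_notMem _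
    filter_upwards [hdd, hne a, hne b, hRS, hv.ae_hasDerivAt_integral]
      with x hx hxa hxb hxRS hFx hxab
    rw [uIcc_of_le hab] at hxab
    have hx' : x ∈ Ioo a b :=
      ⟨lt_of_le_of_ne hxab.1 hxa.symm, lt_of_le_of_ne hxab.2 hxb⟩
    by_cases hxT : x ∈ T
    · refine HasDerivWithinAt.comp_lastControlTime hT hjump hx' hxT ?_
      have h1 := (hasDeltaDerivAt_iff_hasDerivWithinAt (hT.jump_eq_self hxT hxRS)).1
        (hx hxT ⟨hx'.1.le, hx'.2⟩)
      have h2 := hFx (by rwa [uIcc_of_le hab]) a left_mem_uIcc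
      rw [hT.lastControlTime_of_mem hxT] at h2
      exact sub_self (v x) ▸ h1.sub h2.hasDerivWithinAt
    · obtain ⟨h1, h2⟩ := hT.lt_jump_lastControlTime hx'.1.le hxT
      refine (hasDerivAt_const x ((fun t => q t - F t) (lastControlTime T x))).congr_of_eventuallyEq
        ?_
      filter_upwards [Ioo_mem_nhds h1 h2] with s hs
      rw [Function.comp_apply, hT.lastControlTime_eq_of_mem_Ico
        (hT.lastControlTime_mem hx'.1.le) ⟨hs.1.le, hs.2⟩]
  obtain ⟨c, hc⟩ := hac.const_of_ae_hasDerivAt_zero hzero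
  rw [uIcc_of_le hab] at hc
  intro t ht
  have h1 := hc t ht.2
  have h2 := hc a ⟨le_rfl, hab⟩
  simp only [Function.comp_apply, hT.lastControlTime_of_mem ht.1,
    hT.lastControlTime_of_mem hT.isLeast.1] at h1 h2
  have h3 : F a = 0 := intervalIntegral.integral_same
  rw [h3, sub_zero] at h2
  rw [h2, ← h1, sub_add_cancel]

/-- Differentiation of integrals on a time scale. -/
theorem IsTimeScale.ae_hasDeltaDerivAt [CompleteSpace E] (hT : IsTimeScale T a) (hb : b ∈ T)
    (hv : IntervalIntegrable (fun s => v (lastControlTime T s)) volume a b)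
    (hq : ∀ t ∈ Icc a b, q t = q a + ∫ s in a..t, v (lastControlTime T s)) :
    ∀ᵐ t ∂((deltaMeasure T).restrict (Ico a b)), HasDeltaDerivAt T q (v t) t := by
  have hab := hT.le_of_mem hb
  rw [hT.ae_restrict_Ico_iff]
  constructor
  · have hne : ∀ c : ℝ, ∀ᵐ s : ℝ, s ≠ c := fun c => by simp [ae_iff]
    have hRS : ∀ᵐ s : ℝ, s ∉ rightScattered T :=
      (IsTimeScale.countable_rightScattered T).ae_notMem _
    filter_upwards [hne a, hRS, hv.ae_hasDerivAt_integral] with t hta htRS hFt htT htab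
    rw [hasDeltaDerivAt_iff_hasDerivWithinAt (hT.jump_eq_self htT htRS)]
    have h2 := hFt (by rw [uIcc_of_le hab]; exact ⟨htab.1, htab.2.le⟩) a left_mem_uIcc
    rw [hT.lastControlTime_of_mem htT] at h2
    refine ((h2.const_add (q a)).congr_of_eventuallyEq ?_).hasDerivWithinAt
    filter_upwards [Ioo_mem_nhds (lt_of_le_of_ne htab.1 hta.symm) htab.2] with s hs
    exact hq s ⟨hs.1.le, hs.2.le⟩
  · intro r hr hrab
    have hint : ∀ z ∈ Icc a b,
        IntervalIntegrable (fun s => v (lastControlTime T s)) volume a z := fun z hz =>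
      hv.mono_set (by rw [uIcc_of_le hab, uIcc_of_le hz.1]; exact Icc_subset_Icc_right hz.2)
    have hj : jump T r ∈ Icc a b := ⟨hrab.1.trans (hT.le_jump r), jump_le hb hrab.2⟩
    -- A right-scattered point may be left-dense, so the increment over the gap is not enough:
    -- continuity of `q` at `r` is needed as well.
    refine hasDeltaDerivAt_of_jump_sub hr ?_ ?_
    · have hc : ContinuousOn q (Icc a b) := by
        refine ContinuousOn.congr ?_ hq
        refine continuousOn_const.add ?_
        have := intervalIntegral.continuousOn_primitive_interval (μ := volume)
          (f := fun s => v (lastControlTime T s)) (a := a) (b := b)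
          (by rwa [uIcc_of_le hab, ← intervalIntegrable_iff_integrableOn_Icc_of_le hab])
        rwa [uIcc_of_le hab] at this
      refine (hc r ⟨hrab.1, hrab.2.le⟩).mono_of_mem_nhdsWithin ?_
      filter_upwards [mem_nhdsWithin_of_mem_nhds (Iio_mem_nhds hrab.2), self_mem_nhdsWithin]
        with s hs hsT
      exact ⟨hT.le_of_mem hsT, hs.le⟩
    · rw [hq _ hj, hq r ⟨hrab.1, hrab.2.le⟩, add_sub_add_left_eq_sub,
        intervalIntegral.integral_interval_sub_left (hint _ hj) (hint _ ⟨hrab.1, hrab.2.le⟩),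
        hT.integral_comp_lastControlTime_jump hr.1]

/-! ### Filippov's measurable selection -/

section Selection

variable {X F : Type*} [MeasurableSpace X] [NormedAddCommGroup F] [MeasurableSpace F]
  [BorelSpace F]

/-- On a compact space the norm attains its minimum, so a zero exists exactly when the norm gets
arbitrarily small along a countable dense sequence. -/
lemma measurableSet_exists_eq_zero {C : Type*} [TopologicalSpace C] [CompactSpace C]
    [TopologicalSpace.SeparableSpace C] {g : X → C → F} (hm : ∀ c, Measurable fun x => g x c)
    (hc : ∀ x, Continuous (g x)) : MeasurableSet {x | ∃ c, g x c = 0} := by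
  rcases isEmpty_or_nonempty C with h | h
  · simp
  have : {x | ∃ c, g x c = 0} =
      ⋂ N : ℕ, ⋃ i : ℕ, {x | ‖g x (TopologicalSpace.denseSeq C i)‖ < 1 / ((N : ℝ) + 1)} := by
    ext x
    simp only [mem_ofPred_eq, mem_iInter, mem_iUnion]
    constructor
    · rintro ⟨c, hxc⟩ N
      have ho : IsOpen {c' | ‖g x c'‖ < 1 / ((N : ℝ) + 1)} :=
        isOpen_lt (hc x).norm continuous_const
      exact (TopologicalSpace.denseRange_denseSeq C).exists_mem_open ho
        ⟨c, by simp only [mem_ofPred_eq, hxc, norm_zero]; positivity⟩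
    · intro H
      obtain ⟨c, -, hmin⟩ := isCompact_univ.exists_isMinOn univ_nonempty (hc x).norm.continuousOn
      refine ⟨c, ?_⟩
      by_contra hne
      obtain ⟨N, hN⟩ := exists_nat_one_div_lt (norm_pos_iff.2 hne)
      obtain ⟨i, hi⟩ := H N
      exact absurd ((isMinOn_iff.1 hmin _ (mem_univ _)).trans_lt (hi.trans hN)) (lt_irrefl _)
  rw [this]
  exact MeasurableSet.iInter fun N => MeasurableSet.iUnion fun i =>
    measurableSet_lt (hm _).norm measurable_const

/-- Measurable selection of solutions `ω ∈ Ω` of the equation `G x ω = 0`, for a Carathéodory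
function `G` and a compact set `Ω`. -/
theorem exists_measurable_selection {V : Type*} [MetricSpace V] [MeasurableSpace V] [BorelSpace V]
    {Ω : Set V} (hΩ : IsCompact Ω) (hne : Ω.Nonempty) {G : X → V → F}
    (hm : ∀ ω ∈ Ω, Measurable fun x => G x ω) (hc : ∀ x, ContinuousOn (G x) Ω) :
    ∃ u : X → V, Measurable u ∧ (∀ x, u x ∈ Ω) ∧ ∀ x, (∃ ω ∈ Ω, G x ω = 0) → G x (u x) = 0 := by
  have : CompactSpace Ω := isCompact_iff_compactSpace.1 hΩ
  have : Nonempty Ω := hne.to_subtype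
  have : CompactSpace cantorSet := isCompact_iff_compactSpace.1 isCompact_cantorSet
  -- Parametrizing `Ω` by the Cantor set brings in the order of `ℝ`, so that the least zero is a
  -- canonical choice. It is measurable because its sublevel sets ask for a zero in a compact piece
  -- `{c ≤ α}`.
  obtain ⟨ψ₀, hψ₀, hψ₀s⟩ := exists_nat_bool_continuous_surjective_of_compact Ω
  set ψ : cantorSet → Ω := ψ₀ ∘ cantorSetHomeomorphNatToBool with hψdef
  have hψ : Continuous ψ := hψ₀.comp cantorSetHomeomorphNatToBool.continuous
  have hψs : Function.Surjective ψ := hψ₀s.comp cantorSetHomeomorphNatToBool.surjective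
  set g : X → cantorSet → F := fun x c => G x (ψ c) with hg
  have hgm : ∀ c, Measurable fun x => g x c := fun c => hm _ (ψ c).2
  have hgc : ∀ x, Continuous (g x) := fun x => (hc x).domRestrict.comp hψ
  have hA : ∀ α : ℝ, MeasurableSet {x | ∃ c : cantorSet, (c : ℝ) ≤ α ∧ g x c = 0} := by
    intro α
    have hcl : IsClosed {c : cantorSet | (c : ℝ) ≤ α} :=
      isClosed_le continuous_subtype_val continuous_const
    have : CompactSpace {c : cantorSet | (c : ℝ) ≤ α} :=
      isCompact_iff_compactSpace.1 hcl.isCompact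
    have := measurableSet_exists_eq_zero (C := {c : cantorSet | (c : ℝ) ≤ α})
      (g := fun x c => g x c) (fun c => hgm c) (fun x => (hgc x).comp continuous_subtype_val)
    convert this using 3 with x
    simp
  have hsel : ∀ x, ∃ c : cantorSet, ((∃ c', g x c' = 0) → g x c = 0 ∧
      ∀ c', g x c' = 0 → (c : ℝ) ≤ c') ∧ ((¬ ∃ c', g x c' = 0) → (c : ℝ) = 0) := by
    intro x
    by_cases h : ∃ c', g x c' = 0
    · have hcl : IsClosed {c | g x c = 0} := isClosed_eq (hgc x) continuous_const
      obtain ⟨c, hc1, hc2⟩ := hcl.isCompact.exists_isMinOn h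
        (f := fun c : cantorSet => (c : ℝ)) continuous_subtype_val.continuousOn
      exact ⟨c, fun _ => ⟨hc1, fun c' hc' => isMinOn_iff.1 hc2 c' hc'⟩, fun h' => absurd h h'⟩
    -- A fixed default where no zero exists, so that the selection is total and stays measurable.
    · exact ⟨⟨0, zero_mem_cantorSet⟩, fun h' => absurd h' h, fun _ => rfl⟩
  choose c hc1 hc2 using hsel
  have hcm : Measurable c := by
    refine Measurable.subtype_mk (f := fun x => (c x : ℝ)) (measurable_of_Iic fun α => ?_)
    have : (fun x => (c x : ℝ)) ⁻¹' Iic α =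
        {x | ∃ c : cantorSet, (c : ℝ) ≤ α ∧ g x c = 0} ∪
          ({x | ∃ c, g x c = 0}ᶜ ∩ {_x | (0 : ℝ) ≤ α}) := by
      ext x
      simp only [mem_preimage, mem_Iic, mem_union, mem_inter_iff, mem_compl_iff, mem_ofPred_eq]
      by_cases h : ∃ c', g x c' = 0
      · constructor
        · exact fun hx => Or.inl ⟨c x, hx, (hc1 x h).1⟩
        · rintro (⟨c', hc', h0⟩ | ⟨h', _⟩)
          · exact ((hc1 x h).2 c' h0).trans hc'
          · exact absurd h h'
      · rw [hc2 x h]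
        constructor
        · exact fun hx => Or.inr ⟨h, hx⟩
        · rintro (⟨c', -, h0⟩ | ⟨_, h'⟩)
          · exact absurd ⟨c', h0⟩ h
          · exact h'
    rw [this]
    exact (hA α).union ((measurableSet_exists_eq_zero hgm hgc).compl.inter (MeasurableSet.const _))
  refine ⟨fun x => ψ (c x), measurable_subtype_coe.comp (hψ.measurable.comp hcm),
    fun x => (ψ (c x)).2, fun x hx => ?_⟩
  obtain ⟨ω, hω, h0⟩ := hx
  obtain ⟨c', hc'⟩ := hψs ⟨ω, hω⟩
  exact (hc1 x ⟨c', by rw [hg]; simpa [hc'] using h0⟩).1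

end Selection

/-! ### Derivatives of limits of integral curves -/

section Limit

variable {F : Type*} [NormedAddCommGroup F] [NormedSpace ℝ F]

/-- A derivative of a pointwise limit of integrals `∫ H k` belongs to a closed convex set `K` as
soon as the integrands `H k` are locally close to `K`. -/
theorem mem_of_hasDerivAt_of_tendsto [CompleteSpace F] {ι : Type*} {l : Filter ι} [l.NeBot]
    {y H : ι → ℝ → F} {z : ℝ → F} {w : F} {t : ℝ} {K : Set F} (hKc : IsClosed K)
    (hK : Convex ℝ K) (hint : ∀ k s, t ≤ s → IntervalIntegrable (H k) volume t s)
    (hy : ∀ k s, t ≤ s → y k s - y k t = ∫ x in t..s, H k x)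
    (hlim : ∀ s, t ≤ s → Tendsto (fun k => y k s) l (𝓝 (z s))) (hd : HasDerivAt z w t)
    (hmem : ∀ ε > 0, ∃ η > 0, ∀ s ∈ Ioo t (t + η), ∀ᶠ k in l, ∀ᵐ x, x ∈ Ioc t s →
      H k x ∈ Metric.cthickening ε K) : w ∈ K := by
  have key : ∀ ε > 0, w ∈ Metric.cthickening ε K := by
    intro ε hε
    obtain ⟨η, hη, h⟩ := hmem ε hε
    have hcl : IsClosed (Metric.cthickening ε K) := Metric.isClosed_cthickening
    have hslope : Tendsto (slope z t) (𝓝[>] t) (𝓝 w) :=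
      (hasDerivAt_iff_tendsto_slope.1 hd).mono_left
        (nhdsWithin_mono _ fun s hs => ne_of_gt hs)
    refine hcl.mem_of_tendsto hslope ?_
    filter_upwards [Ioo_mem_nhdsGT (show t < t + η by linarith)] with s hs
    -- The slope of `y k` is the average of `H k` over `(t, s]`, so it stays in the closed convex
    -- thickening. Hence pointwise convergence of `y k` suffices, with no convergence of `H k`.
    have hlim' : Tendsto (fun k => slope (y k) t s) l (𝓝 (slope z t s)) := by
      simp only [slope_def_module]
      exact ((hlim s hs.1.le).sub (hlim t le_rfl)).const_smul _
    refine hcl.mem_of_tendsto hlim' ?_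
    filter_upwards [h s hs] with k hk
    rw [slope_def_module, hy k s hs.1.le, ← interval_average_eq, uIoc_of_le hs.1.le]
    refine Convex.set_average_mem (hK.cthickening ε) hcl ?_ ?_ ?_ ?_
    · simpa using hs.1
    · simp
    · rwa [ae_restrict_iff' measurableSet_Ioc]
    · exact (intervalIntegrable_iff_integrableOn_Ioc_of_le hs.1.le).1 (hint k s hs.1.le)
  have := Metric.closure_eq_iInter_cthickening K
  rw [hKc.closure_eq] at this
  rw [this]
  exact mem_iInter₂.2 key

theorem eq_add_integral_of_lipschitzWith [CompleteSpace F] {z w : ℝ → F} {L : NNReal} {a b : ℝ}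
    {C : ℝ} (hab : a ≤ b) (hz : LipschitzWith L z) (hw : IntervalIntegrable w volume a b)
    (hC : ∀ᵐ s, s ∈ Ico a b → ‖w s‖ ≤ C)
    (hd : ∀ᵐ s, s ∈ Ico a b → HasDerivAt z (w s) s) :
    ∀ t ∈ Icc a b, z t = z a + ∫ s in a..t, w s := by
  have hne : ∀ᵐ s : ℝ, s ≠ b := by simp [ae_iff]
  have hFac : AbsolutelyContinuousOnInterval (fun t => ∫ s in a..t, w s) a b := by
    refine (LipschitzOnWith.of_dist_le_mul (K := C.toNNReal) ?_).absolutelyContinuousOnInterval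
    have key : ∀ x ∈ Icc a b, ∀ y ∈ Icc a b, x ≤ y →
        dist (∫ s in a..y, w s) (∫ s in a..x, w s) ≤ C.toNNReal * dist y x := by
      intro x hx y hy hxy
      rw [dist_eq_norm, Real.dist_eq, abs_of_nonneg (sub_nonneg.2 hxy)]
      exact (norm_integral_sub_le hw hC hx hy hxy).trans
        (mul_le_mul_of_nonneg_right (Real.le_coe_toNNReal C) (sub_nonneg.2 hxy))
    rw [uIcc_of_le hab]
    intro x hx y hy
    rcases le_total x y with h | h
    · rw [dist_comm, dist_comm x y]
      exact key x hx y hy h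
    · exact key y hy x hx h
  have hac : AbsolutelyContinuousOnInterval (fun t => z t - ∫ s in a..t, w s) a b :=
    hz.lipschitzOnWith.absolutelyContinuousOnInterval.sub hFac
  obtain ⟨c, hc⟩ := hac.const_of_ae_hasDerivAt_zero (by
    filter_upwards [hd, hne, hw.ae_hasDerivAt_integral] with s hs hsb hFs hsab
    have h2 := hFs hsab a left_mem_uIcc
    rw [uIcc_of_le hab] at hsab
    exact sub_self (w s) ▸ (hs ⟨hsab.1, lt_of_le_of_ne hsab.2 hsb⟩).sub h2)
  rw [uIcc_of_le hab] at hc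
  intro t ht
  have h1 := hc t ht
  have h2 := hc a ⟨le_rfl, hab⟩
  rw [intervalIntegral.integral_same, sub_zero] at h2
  rw [h2, ← h1, sub_add_cancel]

end Limit

/-! ### Transfer of measures and controls to real time; ultrafilter limits -/

lemma restrict_Ico_eq_map {T : Set ℝ} {a b : ℝ} (hT : IsTimeScale T a) (hb : b ∈ T) :
    (deltaMeasure T).restrict (Ico a b) =
      (volume.restrict (Ico a b)).map (lastControlTime T) := by
  rw [← hT.map_lastControlTime, Measure.restrict_map_of_aemeasurable
    hT.aemeasurable_lastControlTime measurableSet_Ico, Measure.restrict_restrict' measurableSet_Ici]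
  congr 2
  ext s
  simp only [mem_inter_iff, mem_preimage, mem_Ico, mem_Ici]
  constructor
  · rintro ⟨⟨_, h2⟩, h3⟩
    exact ⟨h3, (hT.lastControlTime_lt_iff h3 hb).1 h2⟩
  · rintro ⟨h1, h2⟩
    exact ⟨⟨hT.le_lastControlTime_self h1, (hT.lastControlTime_lt_iff h1 hb).2 h2⟩, h1⟩

lemma aemeasurable_lastControlTime_Ico {T : Set ℝ} {a b : ℝ} (hT : IsTimeScale T a) :
    AEMeasurable (lastControlTime T) (volume.restrict (Ico a b)) :=
  hT.aemeasurable_lastControlTime.mono_measure (Measure.restrict_mono Ico_subset_Ici_self le_rfl)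

lemma ae_deltaMeasure_mem {T : Set ℝ} {a : ℝ} (hT : IsTimeScale T a) :
    ∀ᵐ t ∂(deltaMeasure T), t ∈ T :=
  (ae_deltaMeasure_iff T).2 ⟨ae_restrict_mem hT.isClosed.measurableSet, fun _ hr => hr.1⟩

lemma aestronglyMeasurable_comp_lastControlTime {V : Type*} [TopologicalSpace V]
    {T T₁ : Set ℝ} {a : ℝ} {u : ℝ → V} (hT : IsTimeScale T a) (hT₁ : IsTimeScale T₁ a)
    (hsub : T₁ ⊆ T) (hu : AEStronglyMeasurable u (deltaMeasure T₁)) :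
    AEStronglyMeasurable (fun t => u (lastControlTime T₁ t)) (deltaMeasure T) := by
  have hm : AEMeasurable (lastControlTime T₁) (deltaMeasure T) := by
    have : (deltaMeasure T).restrict (Ici a) = deltaMeasure T :=
      Measure.restrict_eq_self_of_ae_mem
        ((ae_deltaMeasure_mem hT).mono fun t ht => hT.le_of_mem ht)
    rw [← this]
    exact aemeasurable_restrict_of_monotoneOn measurableSet_Ici hT₁.monotoneOn_lastControlTime
  refine AEStronglyMeasurable.comp_aemeasurable ?_ hm
  -- Both measures are images of Lebesgue measure, and projecting onto `T` and then `T₁` is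
  -- projecting onto `T₁`.
  have : (deltaMeasure T).map (lastControlTime T₁) = deltaMeasure T₁ := by
    rw [← hT.map_lastControlTime] at hm ⊢
    rw [AEMeasurable.map_map_of_aemeasurable hm hT.aemeasurable_lastControlTime,
      ← hT₁.map_lastControlTime]
    refine Measure.map_congr ?_
    filter_upwards [ae_restrict_mem measurableSet_Ici] with s hs
    exact hT.lastControlTime_comp hT₁ hsub hs
  rwa [this]

/-- A single ultrafilter makes every sequence in a compact set converge. It therefore handles final
times, curves at uncountably many times and control values together, with no extraction of
subsequences. -/
lemma exists_tendsto_hyperfilter {X : Type*} [TopologicalSpace X] {K : Set X} (hK : IsCompact K)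
    {x : ℕ → X} (hx : ∀ k, x k ∈ K) :
    ∃ z ∈ K, Tendsto x (hyperfilter ℕ : Filter ℕ) (𝓝 z) :=
  hK.ultrafilter_le_nhds ((hyperfilter ℕ).map x)
    (le_principal_iff.2 (Filter.mem_map.2 (univ_mem' hx)))

/-! ### Bounds, continuity and measurability of the extended velocity -/

namespace OSDCP

variable {n m j : ℕ} {P : OSDCP n m j}


/-- The extended velocity `(f, f⁰)`. -/
noncomputable def velocity (P : OSDCP n m j) (t : ℝ) (x : EuclideanSpace ℝ (Fin n)) (ω : EuclideanSpace ℝ (Fin m)) : EuclideanSpace ℝ (Fin n) × ℝ := (P.f t x ω, P.f₀ t x ω)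

/-- The extended velocity, as a function of real time, along a trajectory and a control. -/
noncomputable def pathVelocity (P : OSDCP n m j) (u : ℝ → EuclideanSpace ℝ (Fin m)) (q : ℝ → EuclideanSpace ℝ (Fin n)) (s : ℝ) : EuclideanSpace ℝ (Fin n) × ℝ :=
  P.velocity (lastControlTime P.T s) (q (lastControlTime P.T s)) (u (lastControlTime P.T₁ s))

lemma Standing.continuousOn_velocity (hP : P.Standing) :
    ContinuousOn (fun z : ℝ × EuclideanSpace ℝ (Fin n) × EuclideanSpace ℝ (Fin m) => P.velocity z.1 z.2.1 z.2.2) (P.T ×ˢ univ) :=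
  hP.continuousOn_f.prodMk hP.continuousOn_f₀

lemma Standing.continuous_velocity (hP : P.Standing) {t : ℝ} (ht : t ∈ P.T) (x : EuclideanSpace ℝ (Fin n)) :
    Continuous (P.velocity t x) :=
  hP.continuousOn_velocity.comp_continuous (f := fun ω : EuclideanSpace ℝ (Fin m) => (t, x, ω)) (by fun_prop)
    fun _ => ⟨ht, mem_univ _⟩

/-- On bounded sets of times and states, the velocities are bounded. -/
lemma Standing.exists_velocity_bound (hP : P.Standing) (hΩ : IsCompact P.Ω) (R M : ℝ) :
    ∃ C : NNReal, ∀ t ∈ P.T ∩ Icc P.a M, ∀ x : EuclideanSpace ℝ (Fin n), ‖x‖ ≤ R → ∀ ω ∈ P.Ω,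
      ‖P.velocity t x ω‖ ≤ C := by
  have hK : IsCompact ((P.T ∩ Icc P.a M) ×ˢ (Metric.closedBall (0 : EuclideanSpace ℝ (Fin n)) R ×ˢ P.Ω)) :=
    (isCompact_Icc.inter_left hP.timeScale.isClosed).prod
      ((isCompact_closedBall 0 R).prod hΩ)
  obtain ⟨C, hC⟩ := hK.exists_bound_of_continuousOn
    (hP.continuousOn_velocity.mono fun z hz => ⟨hz.1.1, mem_univ _⟩)
  refine ⟨C.toNNReal, fun t ht x hx ω hω => (hC (t, x, ω) ⟨ht, ?_, hω⟩).trans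
    (Real.le_coe_toNNReal C)⟩
  simpa using hx

lemma Standing.exists_uniform_velocity (hP : P.Standing) (hΩ : IsCompact P.Ω) {t : ℝ}
    (ht : t ∈ P.T) (x : EuclideanSpace ℝ (Fin n)) {ε : ℝ} (hε : 0 < ε) :
    ∃ δ > 0, ∀ s ∈ P.T, dist s t < δ → ∀ x', dist x' x < δ → ∀ ω ∈ P.Ω,
      dist (P.velocity s x' ω) (P.velocity t x ω) < ε := by
  have key : ∀ᶠ p : ℝ × EuclideanSpace ℝ (Fin n) in 𝓝 (t, x), ∀ ω ∈ P.Ω, p.1 ∈ P.T →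
      dist (P.velocity p.1 p.2 ω) (P.velocity t x ω) < ε := by
    -- Compactness of `Ω` turns continuity at each `(t, x, ω)` into closeness uniform in `ω`; both
    -- velocities are compared with the one at the centre `ω`, at cost `ε / 2` each.
    refine hΩ.eventually_forall_of_forall_eventually fun ω _ => ?_
    have h1 := (Metric.continuousOn_iff.1 hP.continuousOn_velocity) (t, x, ω) ⟨ht, mem_univ _⟩
      (ε / 2) (half_pos hε)
    obtain ⟨δ, hδ, h⟩ := h1
    filter_upwards [Metric.ball_mem_nhds ((t, x), ω) hδ] with z hz hzT
    have hz1 : dist z.1.1 t < δ ∧ dist z.1.2 x < δ ∧ dist z.2 ω < δ := by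
      simpa [Metric.mem_ball, Prod.dist_eq, and_assoc] using hz
    have h2 := h (z.1.1, z.1.2, z.2) ⟨hzT, mem_univ _⟩ (by simpa [Prod.dist_eq] using hz1)
    have h3 := h (t, x, z.2) ⟨ht, mem_univ _⟩ (by simpa [Prod.dist_eq, hδ] using hz1.2.2)
    exact (dist_triangle_right _ _ _).trans_lt (by linarith)
  obtain ⟨δ, hδ, h⟩ := Metric.eventually_nhds_iff_ball.1 key
  refine ⟨δ, hδ, fun s hs hst x' hx' ω hω => h (s, x') ?_ ω hω hs⟩
  simpa [Metric.mem_ball, Prod.dist_eq] using ⟨hst, hx'⟩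

lemma aestronglyMeasurable_velocity (hP : P.Standing) {b : ℝ} {u : ℝ → EuclideanSpace ℝ (Fin m)} {q : ℝ → EuclideanSpace ℝ (Fin n)}
    (hu : IsControl P.T₁ P.Ω u) (hq : ContinuousOn q (P.T ∩ Icc P.a b)) :
    AEStronglyMeasurable
      (fun t => P.velocity t (q t) (u (lastControlTime P.T₁ t)))
      ((deltaMeasure P.T).restrict (Ico P.a b)) := by
  have hT := hP.timeScale
  have hTm := hT.isClosed.measurableSet
  set μ := (deltaMeasure P.T).restrict (Ico P.a b) with hμ
  have hmem : ∀ᵐ t ∂μ, t ∈ P.T ∩ Icc P.a b := by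
    filter_upwards [ae_restrict_of_ae (ae_deltaMeasure_mem hT), ae_restrict_mem measurableSet_Ico]
      with t h1 h2
    exact ⟨h1, Ico_subset_Icc_self h2⟩
  have hqm : AEMeasurable q μ := by
    have := hq.aemeasurable (μ := μ) (hTm.inter measurableSet_Icc)
    rwa [Measure.restrict_eq_self_of_ae_mem hmem] at this
  have hum : AEMeasurable (fun t => u (lastControlTime P.T₁ t)) μ :=
    ((aestronglyMeasurable_comp_lastControlTime hT hP.timeScale₁ hP.subset
      hu.1.aestronglyMeasurable).mono_measure Measure.restrict_le_self).aemeasurable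
  have htr : AEMeasurable (fun t => (t, q t, u (lastControlTime P.T₁ t))) μ :=
    aemeasurable_id.prodMk (hqm.prodMk hum)
  have hGm : AEMeasurable (fun z : ℝ × EuclideanSpace ℝ (Fin n) × EuclideanSpace ℝ (Fin m) => P.velocity z.1 z.2.1 z.2.2)
      (μ.map fun t => (t, q t, u (lastControlTime P.T₁ t))) := by
    have hS : MeasurableSet (P.T ×ˢ (univ : Set (EuclideanSpace ℝ (Fin n) × EuclideanSpace ℝ (Fin m)))) := hTm.prod MeasurableSet.univ
    have := hP.continuousOn_velocity.aemeasurable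
      (μ := μ.map fun t => (t, q t, u (lastControlTime P.T₁ t))) hS
    rwa [Measure.restrict_eq_self_of_ae_mem] at this
    exact (ae_map_iff htr (p := fun z => z ∈ P.T ×ˢ univ) hS).2
      (hmem.mono fun t ht => ⟨ht.1, mem_univ _⟩)
  exact (hGm.comp_aemeasurable htr).aestronglyMeasurable

lemma ae_control_mem (hP : P.Standing) {u : ℝ → EuclideanSpace ℝ (Fin m)} (hu : IsControl P.T₁ P.Ω u) :
    ∀ᵐ s, P.a ≤ s → u (lastControlTime P.T₁ s) ∈ P.Ω :=
  hP.timeScale₁.ae_comp_lastControlTime hu.2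

/-! ### Admissible trajectories as integral curves in real time -/

section Admissible

variable {b C R M : ℝ} {u : ℝ → EuclideanSpace ℝ (Fin m)} {q : ℝ → EuclideanSpace ℝ (Fin n)}

lemma Standing.mem_of_mem_finalTime (hP : P.Standing) (hb : b ∈ P.B) : b ∈ P.T := by
  rcases hP.finalTime with h | ⟨b₀, h, hB⟩
  · exact h ▸ hb
  · rw [hB] at hb
    exact hb ▸ h

lemma Standing.isClosed_finalTime (hP : P.Standing) : IsClosed P.B := by
  rcases hP.finalTime with h | ⟨b₀, _, hB⟩
  · exact h ▸ hP.timeScale.isClosed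
  · exact hB ▸ isClosed_singleton

lemma norm_pathVelocity_le (hP : P.Standing) (hbM : b ≤ M)
    (hu : IsControl P.T₁ P.Ω u) (hR : ∀ t ∈ P.T ∩ Icc P.a b, ‖q t‖ ≤ R)
    (hC : ∀ t ∈ P.T ∩ Icc P.a M, ∀ x : EuclideanSpace ℝ (Fin n), ‖x‖ ≤ R → ∀ ω ∈ P.Ω, ‖P.velocity t x ω‖ ≤ C) :
    ∀ᵐ s, s ∈ Ico P.a b → ‖P.pathVelocity u q s‖ ≤ C := by
  filter_upwards [ae_control_mem hP hu] with s hs hsab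
  have hT := hP.timeScale
  have h1 := hT.lastControlTime_mem hsab.1
  have h2 := hT.le_of_mem h1
  have h3 := (hT.lastControlTime_le hsab.1).trans hsab.2.le
  exact hC _ ⟨h1, h2, h3.trans hbM⟩ _ (hR _ ⟨h1, h2, h3⟩) _ (hs hsab.1)

lemma aestronglyMeasurable_pathVelocity (hP : P.Standing) (hb : b ∈ P.T)
    (hu : IsControl P.T₁ P.Ω u) (hq : ContinuousOn q (P.T ∩ Icc P.a b)) :
    AEStronglyMeasurable (P.pathVelocity u q) (volume.restrict (Ico P.a b)) := by
  have hT := hP.timeScale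
  have h1 := aestronglyMeasurable_velocity hP hu hq
  rw [restrict_Ico_eq_map hT hb] at h1
  refine (h1.comp_aemeasurable (aemeasurable_lastControlTime_Ico hT)).congr ?_
  filter_upwards [ae_restrict_mem measurableSet_Ico] with s hs
  simp only [Function.comp_apply, pathVelocity]
  rw [hT.lastControlTime_comp hP.timeScale₁ hP.subset hs.1]

lemma integrableOn_pathVelocity (hP : P.Standing) (hb : b ∈ P.T)
    (hu : IsControl P.T₁ P.Ω u) (hq : ContinuousOn q (P.T ∩ Icc P.a b))
    (hC : ∀ᵐ s, s ∈ Ico P.a b → ‖P.pathVelocity u q s‖ ≤ C) :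
    IntegrableOn (P.pathVelocity u q) (Ico P.a b) :=
  IntegrableOn.of_bound (by simp) (aestronglyMeasurable_pathVelocity hP hb hu hq) C
    ((ae_restrict_iff' measurableSet_Ico).2 hC)

lemma intervalIntegrable_pathVelocity (hP : P.Standing) (hb : b ∈ P.T)
    (hu : IsControl P.T₁ P.Ω u) (hq : ContinuousOn q (P.T ∩ Icc P.a b))
    (hC : ∀ᵐ s, s ∈ Ico P.a b → ‖P.pathVelocity u q s‖ ≤ C) :
    IntervalIntegrable (P.pathVelocity u q) volume P.a b :=
  (intervalIntegrable_iff_integrableOn_Ico_of_le (hP.timeScale.le_of_mem hb)).2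
    (integrableOn_pathVelocity hP hb hu hq hC)

/-- The cost as an integral in real time. -/
lemma cost_eq (hP : P.Standing) (hb : b ∈ P.T)
    (hu : IsControl P.T₁ P.Ω u) (hq : ContinuousOn q (P.T ∩ Icc P.a b))
    (hC : ∀ᵐ s, s ∈ Ico P.a b → ‖P.pathVelocity u q s‖ ≤ C) :
    P.cost b u q = (∫ s in P.a..b, P.pathVelocity u q s).2 := by
  have hT := hP.timeScale
  have h1 : AEStronglyMeasurable (fun t => P.f₀ t (q t) (u (lastControlTime P.T₁ t)))
      ((deltaMeasure P.T).restrict (Ico P.a b)) := (aestronglyMeasurable_velocity hP hu hq).snd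
  have h2 := (ContinuousLinearMap.snd ℝ (EuclideanSpace ℝ (Fin n)) ℝ).intervalIntegral_comp_comm
    (intervalIntegrable_pathVelocity hP hb hu hq hC)
  rw [ContinuousLinearMap.coe_snd'] at h2
  rw [← h2, intervalIntegral.integral_of_le (hT.le_of_mem hb), ← integral_Ico_eq_integral_Ioc,
    cost]
  rw [restrict_Ico_eq_map hT hb] at h1 ⊢
  rw [integral_map (aemeasurable_lastControlTime_Ico hT) h1]
  refine setIntegral_congr_fun measurableSet_Ico fun s hs => ?_
  simp only [pathVelocity, velocity]
  rw [hT.lastControlTime_comp hP.timeScale₁ hP.subset hs.1]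

lemma pathVelocity_fst (hP : P.Standing) {s : ℝ} (hs : P.a ≤ s) :
    (P.pathVelocity u q s).1 = P.f (lastControlTime P.T s) (q (lastControlTime P.T s))
      (u (lastControlTime P.T₁ (lastControlTime P.T s))) := by
  rw [hP.timeScale.lastControlTime_comp hP.timeScale₁ hP.subset hs]
  rfl

lemma intervalIntegrable_dynamics (hP : P.Standing) (hb : b ∈ P.T)
    (hint : IntervalIntegrable (P.pathVelocity u q) volume P.a b) :
    IntervalIntegrable (fun s => P.f (lastControlTime P.T s) (q (lastControlTime P.T s))
      (u (lastControlTime P.T₁ (lastControlTime P.T s)))) volume P.a b := by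
  have hint1 : IntervalIntegrable (fun s => (P.pathVelocity u q s).1) volume P.a b :=
    ⟨hint.1.fst, hint.2.fst⟩
  refine hint1.congr fun s hs => ?_
  rw [uIoc_of_le (hP.timeScale.le_of_mem hb)] at hs
  exact pathVelocity_fst hP hs.1.le

lemma integral_pathVelocity_fst (hP : P.Standing) {t : ℝ} (ht : t ∈ Icc P.a b)
    (hint : IntervalIntegrable (P.pathVelocity u q) volume P.a b) :
    (∫ s in P.a..t, P.pathVelocity u q s).1 =
      ∫ s in P.a..t, P.f (lastControlTime P.T s) (q (lastControlTime P.T s))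
        (u (lastControlTime P.T₁ (lastControlTime P.T s))) := by
  have hintt : IntervalIntegrable (P.pathVelocity u q) volume P.a t :=
    hint.mono_set (by
      rw [uIcc_of_le (ht.1.trans ht.2), uIcc_of_le ht.1]; exact Icc_subset_Icc_right ht.2)
  have h2 := (ContinuousLinearMap.fst ℝ (EuclideanSpace ℝ (Fin n)) ℝ).intervalIntegral_comp_comm
    hintt
  rw [ContinuousLinearMap.coe_fst'] at h2
  rw [← h2]
  refine intervalIntegral.integral_congr fun s hs => ?_
  rw [uIcc_of_le ht.1] at hs
  exact pathVelocity_fst hP hs.1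

/-- An admissible trajectory is the integral of its velocity. -/
lemma IsAdmissible.eq_add_integral (hP : P.Standing) (h : P.IsAdmissible b u q)
    (hC : ∀ᵐ s, s ∈ Ico P.a b → ‖P.pathVelocity u q s‖ ≤ C) :
    ∀ t ∈ P.T ∩ Icc P.a b, q t = q P.a + (∫ s in P.a..t, P.pathVelocity u q s).1 := by
  have hb := hP.mem_of_mem_finalTime h.finalTime_mem
  have hint := intervalIntegrable_pathVelocity hP hb h.control h.absCont.continuousOn hC
  intro t ht
  rw [integral_pathVelocity_fst hP ht.2 hint]
  refine h.absCont.eq_add_integral hP.timeScale hb (C := C)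
    (v := fun t => P.f t (q t) (u (lastControlTime P.T₁ t)))
    (intervalIntegrable_dynamics hP hb hint) ?_ h.dynamics t ht
  filter_upwards [hC] with s hs hsab
  have := (norm_fst_le _).trans (hs hsab)
  rwa [pathVelocity_fst hP hsab.1] at this

/-- The integral of the velocity solves the dynamics. -/
lemma dynamics_of_eq_add_integral (hP : P.Standing) (hb : b ∈ P.T)
    (hint : IntervalIntegrable (P.pathVelocity u q) volume P.a b)
    (h : ∀ t ∈ Icc P.a b, q t = q P.a + (∫ s in P.a..t, P.pathVelocity u q s).1) :
    ∀ᵐ t ∂((deltaMeasure P.T).restrict (Ico P.a b)),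
      HasDeltaDerivAt P.T q (P.f t (q t) (u (lastControlTime P.T₁ t))) t :=
  hP.timeScale.ae_hasDeltaDerivAt hb
    (v := fun t => P.f t (q t) (u (lastControlTime P.T₁ t)))
    (intervalIntegrable_dynamics hP hb hint) fun t ht => by
      rw [h t ht, integral_pathVelocity_fst hP ht hint]

/-- An admissible trajectory, together with its running cost, extends to a Lipschitz function of
real time. -/
lemma IsAdmissible.exists_extension (hP : P.Standing) (h : P.IsAdmissible b u q) {L : NNReal}
    (hL : ∀ᵐ s, s ∈ Ico P.a b → ‖P.pathVelocity u q s‖ ≤ L) :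
    ∃ y H : ℝ → EuclideanSpace ℝ (Fin n) × ℝ, (∀ s t, IntervalIntegrable H volume s t) ∧
      (∀ s t, y t - y s = ∫ x in s..t, H x) ∧ LipschitzWith L y ∧
      (∀ᵐ s, s ∈ Ico P.a b → u (lastControlTime P.T₁ s) ∈ P.Ω ∧
        H s = P.pathVelocity u (fun s => (y s).1) s) ∧
      y P.a = (q P.a, 0) ∧ y b = (q b, P.cost b u q) := by
  have hT := hP.timeScale
  have hb := hP.mem_of_mem_finalTime h.finalTime_mem
  have hab := hT.le_of_mem hb
  have hq := h.absCont.continuousOn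
  -- Extending the velocity by zero puts all trajectories, whatever their final times, on the whole
  -- line with the same Lipschitz constant.
  set H := (Ico P.a b).indicator (P.pathVelocity u q) with hH
  have hHi : ∀ s t, IntervalIntegrable H volume s t := fun s t =>
    ((integrableOn_pathVelocity hP hb h.control hq hL).integrable_indicator
      measurableSet_Ico).intervalIntegrable
  have hHn : ∀ᵐ s, ‖H s‖ ≤ L := by
    filter_upwards [hL] with s hs
    by_cases hsab : s ∈ Ico P.a b
    · rw [hH, indicator_of_mem hsab]
      exact hs hsab
    · rw [hH, indicator_of_notMem hsab, norm_zero]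
      exact L.2
  set y : ℝ → EuclideanSpace ℝ (Fin n) × ℝ := fun t => (q P.a, 0) + ∫ x in P.a..t, H x with hy
  have hsub : ∀ s t, y t - y s = ∫ x in s..t, H x := fun s t => by
    rw [hy]
    simp only [add_sub_add_left_eq_sub]
    exact intervalIntegral.integral_interval_sub_left (hHi _ _) (hHi _ _)
  have hint : ∀ t ∈ Icc P.a b, ∫ x in P.a..t, H x = ∫ x in P.a..t, P.pathVelocity u q x := by
    intro t ht
    refine intervalIntegral.integral_congr_ae ?_
    have hne : ∀ᵐ s : ℝ, s ≠ b := by simp [ae_iff]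
    filter_upwards [hne] with s hs hs'
    rw [uIoc_of_le ht.1] at hs'
    have hsab : s ∈ Ico P.a b := ⟨hs'.1.le, lt_of_le_of_ne (hs'.2.trans ht.2) hs⟩
    rw [hH, indicator_of_mem hsab]
  have hyq : ∀ t ∈ P.T ∩ Icc P.a b, (y t).1 = q t := by
    intro t ht
    rw [h.eq_add_integral hP hL t ht, ← hint t ht.2]
    rfl
  refine ⟨y, H, hHi, hsub, ?_, ?_, ?_, ?_⟩
  · refine LipschitzWith.of_dist_le_mul fun s t => ?_
    rw [dist_eq_norm, hsub, Real.dist_eq]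
    exact intervalIntegral.norm_integral_le_of_norm_le_const_ae (hHn.mono fun s hs _ => hs)
  · filter_upwards [ae_control_mem hP h.control] with s hs hsab
    refine ⟨hs hsab.1, ?_⟩
    have hφ := hT.lastControlTime_mem hsab.1
    rw [hH, indicator_of_mem hsab, pathVelocity, pathVelocity,
      hyq _ ⟨hφ, hT.le_of_mem hφ, (hT.lastControlTime_le hsab.1).trans hsab.2.le⟩]
  · simp [hy]
  · refine Prod.ext (hyq b ⟨hb, hab, le_rfl⟩) ?_
    rw [cost_eq hP hb h.control hq hL, ← hint b ⟨hab, le_rfl⟩]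
    simp [hy]

end Admissible

/-! ### Limits of trajectories and the control that generates them -/

/-- Derivatives of limits of extended trajectories are limits of extended velocities. -/
lemma mem_of_hasDerivAt_limit (hP : P.Standing) (hΩ : IsCompact P.Ω) {l : Filter ℕ} [l.NeBot]
    {bk : ℕ → ℝ} {uk : ℕ → ℝ → EuclideanSpace ℝ (Fin m)} {y H : ℕ → ℝ → EuclideanSpace ℝ (Fin n) × ℝ} {z : ℝ → EuclideanSpace ℝ (Fin n) × ℝ} {C : NNReal}
    (hint : ∀ k s t, IntervalIntegrable (H k) volume s t)
    (hy : ∀ k s t, y k t - y k s = ∫ x in s..t, H k x)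
    (hlip : ∀ k, LipschitzWith C (y k))
    (hH : ∀ k, ∀ᵐ s, s ∈ Ico P.a (bk k) → uk k (lastControlTime P.T₁ s) ∈ P.Ω ∧
      H k s = P.pathVelocity (uk k) (fun s => (y k s).1) s)
    (hlim : ∀ t, Tendsto (fun k => y k t) l (𝓝 (z t))) {b : ℝ} (hb : Tendsto bk l (𝓝 b))
    {t : ℝ} (ht : t ∈ Ico P.a b) {w : EuclideanSpace ℝ (Fin n) × ℝ} (hd : HasDerivAt z w t) {K : Set (EuclideanSpace ℝ (Fin n) × ℝ)}
    (hKc : IsClosed K) (hK : Convex ℝ K)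
    (hKv : ∀ ε > 0, ∃ η > 0, ∀ᶠ k in l, ∀ s ∈ Ico t (t + η),
      uk k (lastControlTime P.T₁ s) ∈ P.Ω →
      P.velocity (lastControlTime P.T t) (z (lastControlTime P.T t)).1
        (uk k (lastControlTime P.T₁ s)) ∈ Metric.cthickening ε K) : w ∈ K := by
  have hT := hP.timeScale
  refine mem_of_hasDerivAt_of_tendsto hKc hK (fun k s _ => hint k t s) (fun k s _ => hy k t s)
    (fun s _ => hlim s) hd fun ε hε => ?_
  set τ := lastControlTime P.T t with hτ
  obtain ⟨η₁, hη₁, h₁⟩ := hKv (ε / 2) (half_pos hε)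
  obtain ⟨δ, hδ, hunif⟩ := hP.exists_uniform_velocity hΩ (hT.lastControlTime_mem ht.1) (z τ).1
    (half_pos hε)
  -- Half of `δ` pays for the Lipschitz drift of `y k` between projected times, the other half for
  -- its convergence at the single time `τ`.
  obtain ⟨δ', hδ', hδδ, hCδ⟩ : ∃ δ' > 0, δ' ≤ δ ∧ C * δ' ≤ δ / 2 := by
    refine ⟨min δ (δ / (2 * (C + 1))), by positivity, min_le_left _ _, ?_⟩
    calc (C : ℝ) * min δ (δ / (2 * (C + 1))) ≤ (C + 1) * (δ / (2 * (C + 1))) := by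
          gcongr
          · linarith
          · exact min_le_right _ _
      _ = δ / 2 := by field_simp
  obtain ⟨η₂, hη₂, h₂⟩ := hT.eventually_lastControlTime ht.1 hδ'
  refine ⟨min (min η₁ η₂) (b - t), lt_min (lt_min hη₁ hη₂) (sub_pos.2 ht.2), fun s hs => ?_⟩
  have hs1 : s < t + η₁ := hs.2.trans_le (by gcongr; exact (min_le_left _ _).trans (min_le_left _ _))
  have hs2 : s < t + η₂ := hs.2.trans_le (by gcongr; exact (min_le_left _ _).trans (min_le_right _ _))
  have hs3 : s < b := hs.2.trans_le (by linarith [min_le_right (min η₁ η₂) (b - t)])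
  filter_upwards [h₁, hb.eventually (lt_mem_nhds hs3),
    (hlim τ).eventually (Metric.ball_mem_nhds (z τ) (half_pos hδ))] with k hk1 hk2 hk3
  filter_upwards [hH k] with x hx hxs
  obtain ⟨hxΩ, hxH⟩ := hx ⟨ht.1.trans hxs.1.le, hxs.2.trans_lt hk2⟩
  have hm := hk1 x ⟨hxs.1.le, hxs.2.trans_lt hs1⟩ hxΩ
  obtain ⟨hφ1, hφ2⟩ := h₂ x ⟨hxs.1.le, hxs.2.trans_lt hs2⟩
  have hdφ : dist (lastControlTime P.T x) τ < δ' := by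
    rw [Real.dist_eq, abs_of_nonneg (sub_nonneg.2 hφ1)]
    linarith
  have hdy : dist (y k (lastControlTime P.T x)).1 (z τ).1 < δ := by
    calc dist (y k (lastControlTime P.T x)).1 (z τ).1
        ≤ dist (y k (lastControlTime P.T x)) (z τ) := by
          rw [Prod.dist_eq]; exact le_max_left _ _
      _ ≤ dist (y k (lastControlTime P.T x)) (y k τ) + dist (y k τ) (z τ) := dist_triangle _ _ _
      _ < δ / 2 + δ / 2 := by
          refine add_lt_add_of_le_of_lt ?_ hk3
          exact ((hlip k).dist_le_mul _ _).trans
            ((mul_le_mul_of_nonneg_left hdφ.le C.2).trans hCδ)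
      _ = δ := add_halves δ
  have hd' := hunif _ (hT.lastControlTime_mem (ht.1.trans hxs.1.le)) (hdφ.trans_le hδδ) _ hdy _ hxΩ
  rw [hxH]
  have hmem : P.pathVelocity (uk k) (fun s => (y k s).1) x ∈
      Metric.cthickening (ε / 2) (Metric.cthickening (ε / 2) K) :=
    Metric.mem_cthickening_of_dist_le _ _ _ _ hm hd'.le
  have := Metric.cthickening_cthickening_subset (half_pos hε).le (half_pos hε).le K hmem
  rwa [add_halves] at this

/-- Selection of a control generating a given velocity field `w` along the trajectory `x`. -/
lemma exists_control_selection (hP : P.Standing) (hΩ : IsCompact P.Ω)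
    {x : ℝ → EuclideanSpace ℝ (Fin n)} (hx : Continuous x)
    {w : ℝ → EuclideanSpace ℝ (Fin n) × ℝ} (hw : Measurable w) :
    ∃ u : ℝ → EuclideanSpace ℝ (Fin m), Measurable u ∧ (∀ t, u t ∈ P.Ω) ∧
      ∀ t ∈ P.T, (∃ ω ∈ P.Ω, P.velocity t (x t) ω = w t) → P.velocity t (x t) (u t) = w t := by
  have hT := hP.timeScale
  set π : ℝ → ℝ := fun t => lastControlTime P.T (max P.a t) with hπ
  have hπT : ∀ t, π t ∈ P.T := fun t => hT.lastControlTime_mem (le_max_left _ _)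
  have hπm : Measurable π := Monotone.measurable fun s t hst =>
    hT.lastControlTime_mono (le_max_left _ _) (max_le_max le_rfl hst)
  obtain ⟨u, hu, huΩ, hsel⟩ := exists_measurable_selection hΩ hP.nonempty_Ω
    (G := fun t ω => P.velocity (π t) (x (π t)) ω - w t) (fun ω _ => by
      refine Measurable.sub ?_ hw
      have hmem : ∀ t, (π t, x (π t), ω) ∈ P.T ×ˢ
          (univ : Set (EuclideanSpace ℝ (Fin n) × EuclideanSpace ℝ (Fin m))) :=
        fun t => ⟨hπT t, mem_univ _⟩
      have h1 := hP.continuousOn_velocity.domRestrict.measurable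
      have h2 : Measurable fun t => (⟨(π t, x (π t), ω), hmem t⟩ : ↥(P.T ×ˢ
          (univ : Set (EuclideanSpace ℝ (Fin n) × EuclideanSpace ℝ (Fin m))))) :=
        (hπm.prodMk ((hx.measurable.comp hπm).prodMk measurable_const)).subtype_mk
      exact h1.comp h2)
    (fun t => ((hP.continuous_velocity (hπT t) _).sub continuous_const).continuousOn)
  refine ⟨u, hu, huΩ, fun t ht ⟨ω, hω, hωw⟩ => ?_⟩
  have hπt : π t = t := by
    rw [hπ]
    simp only [max_eq_right (hT.le_of_mem ht), hT.lastControlTime_of_mem ht]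
  have := hsel t ⟨ω, hω, by rw [hπt, hωw, sub_self]⟩
  rw [hπt] at this
  exact sub_eq_zero.1 this

lemma isControl_of_measurable (hΩ : IsCompact P.Ω) {u : ℝ → EuclideanSpace ℝ (Fin m)}
    (hu : Measurable u) (h : ∀ t, u t ∈ P.Ω) : IsControl P.T₁ P.Ω u := by
  obtain ⟨r, hr⟩ := hΩ.isBounded.exists_norm_le
  exact ⟨memLp_top_of_bound hu.aestronglyMeasurable r (Eventually.of_forall fun t => hr _ (h t)),
    Eventually.of_forall h⟩

/-- Limits of extended admissible trajectories are generated by a control. -/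
lemma exists_control_of_limit (hP : P.Standing) (hΩ : IsCompact P.Ω)
    (hconv : ∀ t ∈ P.T, ∀ x, Convex ℝ (P.extendedVelocities t x))
    {bk : ℕ → ℝ} {uk : ℕ → ℝ → EuclideanSpace ℝ (Fin m)}
    {y H : ℕ → ℝ → EuclideanSpace ℝ (Fin n) × ℝ} {z : ℝ → EuclideanSpace ℝ (Fin n) × ℝ}
    {C : NNReal} (huk : ∀ k, IsControl P.T₁ P.Ω (uk k))
    (hint : ∀ k s t, IntervalIntegrable (H k) volume s t)
    (hy : ∀ k s t, y k t - y k s = ∫ x in s..t, H k x)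
    (hlip : ∀ k, LipschitzWith C (y k))
    (hH : ∀ k, ∀ᵐ s, s ∈ Ico P.a (bk k) → uk k (lastControlTime P.T₁ s) ∈ P.Ω ∧
      H k s = P.pathVelocity (uk k) (fun s => (y k s).1) s)
    (hlim : ∀ t, Tendsto (fun k => y k t) (hyperfilter ℕ : Filter ℕ) (𝓝 (z t)))
    (hz : LipschitzWith C z) {b : ℝ} (hb : Tendsto bk (hyperfilter ℕ : Filter ℕ) (𝓝 b)) :
    ∃ u : ℝ → EuclideanSpace ℝ (Fin m), IsControl P.T₁ P.Ω u ∧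
      ∀ᵐ s, s ∈ Ico P.a b → HasDerivAt z (P.pathVelocity u (fun s => (z s).1) s) s := by
  have hT := hP.timeScale
  have hT₁ := hP.timeScale₁
  -- At an atom of the measure of `T₁` every control takes its value in `Ω`, so the values converge
  -- along the ultrafilter. Other points get an arbitrary element of `Ω`.
  have hscat : ∀ r, ∃ ω ∈ P.Ω, r ∈ rightScattered P.T₁ →
      Tendsto (fun k => uk k r) (hyperfilter ℕ : Filter ℕ) (𝓝 ω) := by
    intro r
    by_cases hr : r ∈ rightScattered P.T₁
    · obtain ⟨ω, hω, h⟩ := exists_tendsto_hyperfilter hΩ (x := fun k => uk k r)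
        fun k => ((ae_deltaMeasure_iff P.T₁).1 (huk k).2).2 r hr
      exact ⟨ω, hω, fun _ => h⟩
    · obtain ⟨ω, hω⟩ := hP.nonempty_Ω
      exact ⟨ω, hω, fun h => absurd h hr⟩
  choose v hvΩ hv using hscat
  obtain ⟨us, husm, husΩ, hus⟩ := exists_control_selection hP hΩ
    (x := fun s => (z s).1) hz.continuous.fst (measurable_deriv z)
  classical
  set u : ℝ → EuclideanSpace ℝ (Fin m) :=
    fun t => if t ∈ rightScattered P.T₁ then v t else us t with hu
  -- The two definitions are glued along a countable set, which preserves measurability.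
  have hum : Measurable u := husm.measurable_of_countable_ne
    ((countable_rightScattered P.T₁).mono fun t ht => by
      by_contra h
      exact ht (by simp [hu, h]))
  have huΩ : ∀ t, u t ∈ P.Ω := fun t => by
    by_cases h : t ∈ rightScattered P.T₁
    · simpa [hu, h] using hvΩ t
    · simpa [hu, h] using husΩ t
  refine ⟨u, isControl_of_measurable hΩ hum huΩ, ?_⟩
  filter_upwards [hz.ae_differentiableAt_real] with t hd ht
  have hdt := hd.hasDerivAt
  suffices deriv z t = P.pathVelocity u (fun s => (z s).1) t by rwa [← this]
  have hφT := hT.lastControlTime_mem ht.1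
  have hcont := hP.continuous_velocity hφT (z (lastControlTime P.T t)).1
  have hlimit := fun K => mem_of_hasDerivAt_limit hP hΩ hint hy hlip hH hlim hb ht hdt (K := K)
  by_cases hr : lastControlTime P.T₁ t ∈ rightScattered P.T₁
  · have hval : u (lastControlTime P.T₁ t) = v (lastControlTime P.T₁ t) := by simp [hu, hr]
    rw [pathVelocity, hval]
    -- Until the end of the gap of `T₁` the controls keep the value at its left end, so all
    -- velocities approach a single one; convexity of the velocity sets plays no role here.
    refine hlimit {_} isClosed_singleton (convex_singleton _) fun ε hε => ?_
    have htr := hT₁.mem_Ico_lastControlTime ht.1 hr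
    refine ⟨jump P.T₁ (lastControlTime P.T₁ t) - t, sub_pos.2 htr.2, ?_⟩
    filter_upwards [((hcont.tendsto _).comp (hv _ hr)).eventually
      (Metric.closedBall_mem_nhds _ hε)] with k hk s hs _
    have hφs : lastControlTime P.T₁ s = lastControlTime P.T₁ t :=
      hT₁.lastControlTime_eq_of_mem_Ico hr.1 ⟨htr.1.trans hs.1, by linarith [hs.2]⟩
    rw [hφs]
    exact Metric.mem_cthickening_of_dist_le _ _ _ _ (mem_singleton _) hk
  · have htT₁ := hT₁.mem_of_lastControlTime_notMem ht.1 hr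
    have htT := hP.subset htT₁
    have hφ₁ := hT₁.lastControlTime_of_mem htT₁
    have hφ := hT.lastControlTime_of_mem htT
    -- Here convexity of the set of extended velocities enters, and compactness of `Ω` makes that
    -- set closed.
    have hmem := hlimit (P.velocity (lastControlTime P.T t) (z (lastControlTime P.T t)).1 '' P.Ω)
      (hΩ.image hcont).isClosed (hconv _ hφT _) fun ε _ => ⟨1, one_pos, Eventually.of_forall
        fun k s _ hω => Metric.self_subset_cthickening _ (mem_image_of_mem _ hω)⟩
    rw [hφ₁] at hr
    rw [hφ] at hmem
    rw [pathVelocity, hφ, hφ₁]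
    have hval : u t = us t := by simp [hu, hr]
    rw [hval]
    exact (hus t htT hmem).symm

/-! ### Minimizing sequence and optimality of the limit -/

/-- Existence of an optimal solution (Filippov's theorem). -/
theorem Standing.exists_isOptimal (hP : P.Standing) (hΩ : IsCompact P.Ω)
    (hne : ∃ b u q, P.IsAdmissible b u q) {M : ℝ}
    (hbound : ∀ b u q, P.IsAdmissible b u q → ∀ t ∈ P.T ∩ Icc P.a b, ‖q t‖ + b ≤ M)
    (hconv : ∀ t ∈ P.T, ∀ x, Convex ℝ (P.extendedVelocities t x)) :
    ∃ b u q, P.IsOptimal b u q := by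
  have hT := hP.timeScale
  -- The radius is `M - a` because `‖q t‖ ≤ M - b` and `b ≥ a`, where `a` may be negative.
  obtain ⟨C, hC⟩ := hP.exists_velocity_bound hΩ (M - P.a) M
  have hadmT : ∀ {b u q}, P.IsAdmissible b u q → b ∈ P.T := fun h =>
    hP.mem_of_mem_finalTime h.finalTime_mem
  have hbM : ∀ {b u q}, P.IsAdmissible b u q → b ≤ M := fun {b u q} h => by
    have := hbound b u q h P.a ⟨hT.isLeast.1, le_rfl, hT.le_of_mem (hadmT h)⟩
    linarith [norm_nonneg (q P.a)]
  have hqR : ∀ {b u q}, P.IsAdmissible b u q → ∀ t ∈ P.T ∩ Icc P.a b, ‖q t‖ ≤ M - P.a :=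
    fun {b u q} h t ht => by
      linarith [hbound b u q h t ht, hT.le_of_mem (hadmT h)]
  have hext := fun {b u q} (h : P.IsAdmissible b u q) => h.exists_extension hP
    (norm_pathVelocity_le hP (hbM h) h.control (hqR h) hC)
  set S : Set ℝ := {c | ∃ b u q, P.IsAdmissible b u q ∧ P.cost b u q = c} with hS
  have hSne : S.Nonempty := by
    obtain ⟨b, u, q, h⟩ := hne
    exact ⟨_, b, u, q, h, rfl⟩
  have hSb : BddBelow S := by
    -- The cost is the increment of a coordinate of a `C`-Lipschitz curve over a time at most `M -
    -- a`.
    refine ⟨-(C * (M - P.a)), ?_⟩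
    rintro _ ⟨b, u, q, h, rfl⟩
    obtain ⟨y, H, -, -, hlip, -, hya, hyb⟩ := hext h
    have h1 := (norm_snd_le (y b - y P.a)).trans (hlip.norm_sub_le b P.a)
    rw [hya, hyb, Real.norm_eq_abs, Real.norm_eq_abs,
      abs_of_nonneg (sub_nonneg.2 (hT.le_of_mem (hadmT h)))] at h1
    simp only [Prod.snd_sub, sub_zero] at h1
    have h2 := mul_le_mul_of_nonneg_left (sub_le_sub_right (hbM h) P.a) C.coe_nonneg
    linarith [neg_abs_le (P.cost b u q)]
  obtain ⟨c, -, hc, hcS⟩ := exists_seq_tendsto_sInf hSne hSb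
  choose bk uk qk hadm hcost using hcS
  choose y H hint hy hlip hH hya hyb using fun k => hext (hadm k)
  have hle : (hyperfilter ℕ : Filter ℕ) ≤ atTop := Nat.hyperfilter_le_atTop
  have hza : ∀ t, ∃ z, Tendsto (fun k => y k t) (hyperfilter ℕ : Filter ℕ) (𝓝 z) := by
    intro t
    obtain ⟨z, -, hz⟩ := exists_tendsto_hyperfilter
      (isCompact_closedBall (0 : EuclideanSpace ℝ (Fin n) × ℝ) (M - P.a + C * |t - P.a|))
      (x := fun k => y k t) fun k => by
        rw [mem_closedBall_zero_iff]
        have h1 := (hlip k).norm_sub_le t P.a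
        have h2 : ‖y k P.a‖ ≤ M - P.a := by
          rw [hya, Prod.norm_mk, norm_zero, max_eq_left (norm_nonneg _)]
          exact hqR (hadm k) P.a ⟨hT.isLeast.1, le_rfl, hT.le_of_mem (hadmT (hadm k))⟩
        rw [Real.norm_eq_abs] at h1
        calc ‖y k t‖ = ‖y k P.a + (y k t - y k P.a)‖ := by rw [add_sub_cancel]
          _ ≤ _ := (norm_add_le _ _).trans (add_le_add h2 h1)
    exact ⟨z, hz⟩
  choose z hz using hza
  obtain ⟨b, ⟨hbB, -⟩, hb⟩ := exists_tendsto_hyperfilter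
    (isCompact_Icc.inter_left hP.isClosed_finalTime) (x := bk) fun k =>
      ⟨(hadm k).finalTime_mem, hT.le_of_mem (hadmT (hadm k)), hbM (hadm k)⟩
  have hbT := hP.mem_of_mem_finalTime hbB
  have hab := hT.le_of_mem hbT
  have hzlip : LipschitzWith C z := LipschitzWith.of_dist_le_mul fun s t =>
    le_of_tendsto' ((hz s).dist (hz t)) fun k => (hlip k).dist_le_mul s t
  -- The common Lipschitz constant absorbs the moving final times: `y k (bk k)` and `y k b` differ
  -- by at most `C * |bk k - b|`.
  have hend : Tendsto (fun k => y k (bk k)) (hyperfilter ℕ : Filter ℕ) (𝓝 (z b)) := by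
    have h1 : Tendsto (fun k => y k (bk k) - y k b) (hyperfilter ℕ : Filter ℕ) (𝓝 0) := by
      refine squeeze_zero_norm (fun k => (hlip k).norm_sub_le _ _) ?_
      have := (hb.sub_const b).norm.const_mul (C : ℝ)
      simpa using this
    simpa using h1.add (hz b)
  simp only [hyb] at hend
  have hstart := hz P.a
  simp only [hya] at hstart
  have hzb : (z b).2 = sInf S := by
    refine tendsto_nhds_unique ((continuous_snd.tendsto _).comp hend) ?_
    simpa only [Function.comp_def, hcost] using hc.mono_left hle
  have hza2 : (z P.a).2 = 0 :=
    tendsto_nhds_unique ((continuous_snd.tendsto _).comp hstart) tendsto_const_nhds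
  obtain ⟨u, hu, hderiv⟩ := exists_control_of_limit hP hΩ hconv (fun k => (hadm k).control)
    hint hy hlip hH hz hzlip hb
  set q : ℝ → EuclideanSpace ℝ (Fin n) := fun s => (z s).1 with hq
  have hqlip : LipschitzWith C q := by
    simpa [hq, Function.comp_def] using LipschitzWith.prod_fst.comp hzlip
  have hqc : ContinuousOn q (P.T ∩ Icc P.a b) := hqlip.continuous.continuousOn
  -- The velocity of the limit is almost everywhere a derivative of `z`, so the Lipschitz constant
  -- bounds it.
  have hpv : ∀ᵐ s, s ∈ Ico P.a b → ‖P.pathVelocity u q s‖ ≤ C := by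
    filter_upwards [hderiv] with s hs hsab
    rw [← (hs hsab).deriv]
    exact norm_deriv_le_of_lipschitz hzlip
  have hpi := intervalIntegrable_pathVelocity hP hbT hu hqc hpv
  have hzint := eq_add_integral_of_lipschitzWith hab hzlip hpi hpv hderiv
  have hadmq : P.IsAdmissible b u q :=
    { finalTime_mem := hbB
      control := hu
      absCont := isAbsContOn_of_norm_sub_le (C := C) fun s _ t _ hst => by
        have := hqlip.norm_sub_le t s
        rwa [Real.norm_eq_abs, abs_of_nonneg (sub_nonneg.2 hst)] at this
      dynamics := dynamics_of_eq_add_integral hP hbT hpi fun t ht => by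
        rw [hq]
        simp only
        rw [hzint t ht]
        rfl
      terminal := by
        have h1 : Tendsto (fun k => P.g (qk k P.a) (qk k (bk k)))
            (hyperfilter ℕ : Filter ℕ) (𝓝 (P.g (q P.a) (q b))) :=
          (hP.continuous_g.tendsto (q P.a, q b)).comp
            (((continuous_fst.tendsto _).comp hstart).prodMk_nhds
              ((continuous_fst.tendsto _).comp hend))
        exact hP.isClosed_S.mem_of_tendsto h1 (Eventually.of_forall fun k => (hadm k).terminal) }
  refine ⟨b, u, q, hadmq, fun b' u' q' h' => ?_⟩
  have hcostq : P.cost b u q = sInf S := by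
    rw [cost_eq hP hbT hu hqc hpv, ← hzb, hzint b ⟨hab, le_rfl⟩, Prod.snd_add, hza2, zero_add]
  rw [hcostq]
  exact csInf_le hSb ⟨b', u', q', h', rfl⟩

end OSDCP

end TimeScale

theorem mainTheorem3 {n m j : ℕ} (hn : 0 < n) (hm : 0 < m) (hj : 0 < j)
    (P : TimeScale.OSDCP n m j) (hP : P.Standing)
    (hΩ : IsCompact P.Ω)
    (hne : ∃ (b : ℝ) (u : ℝ → EuclideanSpace ℝ (Fin m)) (q : ℝ → EuclideanSpace ℝ (Fin n)),
      P.IsAdmissible b u q)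
    (M : ℝ) (hM : 0 ≤ M)
    (hbound : ∀ (b : ℝ) (u : ℝ → EuclideanSpace ℝ (Fin m)) (q : ℝ → EuclideanSpace ℝ (Fin n)),
      P.IsAdmissible b u q → ∀ t ∈ P.T ∩ Set.Icc P.a b, ‖q t‖ + b ≤ M)
    (hconv : ∀ t ∈ P.T, ∀ x : EuclideanSpace ℝ (Fin n), Convex ℝ (P.extendedVelocities t x)) :
    ∃ (b : ℝ) (u : ℝ → EuclideanSpace ℝ (Fin m)) (q : ℝ → EuclideanSpace ℝ (Fin n)),
      P.IsOptimal b u q :=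
  hP.exists_isOptimal hΩ hne hbound hconv
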